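/- **Setting.** A Lorentzian Kaehler surface $(\tilde M,\tilde g,J)$ is a smooth manifold of real dimension $4$ with a smooth indefinite metric $\tilde g$ and an almost complex structure $J$ such that $\tilde g(JX,JY)=\tilde g(X,Y)$, $\tilde\nabla J=0$ for the Levi-Civita connection $\tilde\nabla$ of $\tilde g$, and the largest complex negative definite subspaces of each tangent space have complex dimension one. A Lorentz surface $(M,g)$ is a smooth $2$-manifold with a smooth metric of index one, with Levi-Civita connection $\nabla$. For a smooth isometric immersion $\phi:M\to\tilde M$ the second fundamental form $h$, the shape operator $A$ and the normal connection $D$ are defined by $\tilde\nabla_XY=\nabla_XY+h(X,Y)$ and $\tilde\nabla_X\xi=-A_\xi X+D_X\xi$ for $X,Y$ tangent and $\xi$ normal to $M$, and $(\bar\nabla_Xh)(Y,Z)=D_Xh(Y,Z)-h(\nabla_XY,Z)-h(Y,\nabla_XZ)$. With $R,R^D,\tilde R$ the curvature tensors of $\nabla,D,\tilde\nabla$, $R(X,Y;Z,W)=g(R(X,Y)Z,W)$ and $\tilde R(X,Y;Z,W)=\tilde g(\tilde R(X,Y)Z,W)$, the equations of Gauss, Codazzi and Ricci are, for $X,Y,Z,W$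 tangent and $\xi,\eta$ normal to $M$, $$R(X,Y;Z,W)=\tilde R(X,Y;Z,W)+\tilde g(h(X,W),h(Y,Z))-\tilde g(h(X,Z),h(Y,W)),$$ $$(\tilde R(X,Y)Z)^\perp=(\bar\nabla_Xh)(Y,Z)-(\bar\nabla_Yh)(X,Z),$$ $$\tilde g(R^D(X,Y)\xi,\eta)=\tilde R(X,Y;\xi,\eta)+g([A_\xi,A_\eta]X,Y).$$ **Theorem.** The equation of Ricci is a consequence of the equations of Gauss and Codazzi for any Lorentz surface in any Lorentzian Kaehler surface. Precisely: (a) Let $\phi:M\to\tilde M$ be a smooth isometric immersion of a Lorentz surface into a Lorentzian Kaehler surface, and let $p\in M$. If the equations of Gauss and Codazzi hold at $p$, then the equation of Ricci holds at $p$. (b) The implication does not depend on $\tilde R$ being the curvature of the connection in the formulas of Gauss and Weingarten. Let $U\subset\mathbb R^2$ be open with a smooth Lorentz metric $g$, and let $\mathcal E=U\times\mathbb R^4$ carry a smooth fibre metric $G$, a smooth complex structure $J$ on the fibres for which $G$ is Hermitian of complex index one, a smooth connection $\tilde\nabla$ with $\tilde\nabla G=0$ and $\tilde\nabla J=0$,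 and a smooth bundle map $\iota:TU\to\mathcal E$, isometric on each fibre, with $\tilde\nabla_X(\iota Y)-\tilde\nabla_Y(\iota X)=\iota[X,Y]$. Define $\nabla$ (the Levi-Civita connection of $g$), $h,A,D,\bar\nabla h,R,R^D$ by the formulas above, identifying $TU$ with $\iota(TU)$. Let $x\in U$, and let $\tilde R$ be any trilinear map $(X,Y,Z)\mapsto\tilde R(X,Y)Z$ on the fibre $\mathcal E_x$ such that $\tilde R(X,Y;Z,W)=G(\tilde R(X,Y)Z,W)$ satisfies $$\tilde R(X,Y;Z,W)=-\tilde R(Y,X;Z,W),\quad \tilde R(X,Y;Z,W)=\tilde R(Z,W;X,Y),\quad \tilde R(X,Y;JZ,W)=-\tilde R(X,Y;Z,JW).$$ If the equations of Gauss and Codazzi hold at $x$ with this $\tilde R$, then so does the equation of Ricci. -/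

import Mathlib

set_option maxSynthPendingDepth 3

open scoped Manifold ContDiff

noncomputable section

namespace LorentzKaehler

/-! ### Indefinite scalar products -/

section LinearAlgebra

variable {V : Type*} [AddCommGroup V] [Module ℝ V] [TopologicalSpace V]
  [IsTopologicalAddGroup V] [ContinuousSMul ℝ V]

/-- `B` is negative definite on the subspace `N`. -/
def NegDefOn (B : V →L[ℝ] V →L[ℝ] ℝ) (N : Submodule ℝ V) : Prop :=
  ∀ v ∈ N, v ≠ 0 → B v v < 0

/-- An indefinite scalar product: symmetric and nondegenerate. -/
structure IsScalarProduct (B : V →L[ℝ] V →L[ℝ] ℝ) : Prop where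
  symm : ∀ u v, B u v = B v u
  nondegenerate : ∀ u, (∀ v, B u v = 0) → u = 0

/-- Lorentzian: the largest negative definite subspaces have dimension one. -/
def IsLorentzian (B : V →L[ℝ] V →L[ℝ] ℝ) : Prop :=
  IsGreatest {k : ℕ | ∃ N : Submodule ℝ V, NegDefOn B N ∧ Module.finrank ℝ N = k} 1

/-- The complex index is one: the largest complex (i.e. `J`-stable) negative definite subspaces
have complex dimension one. -/
def HasComplexIndexOne (B : V →L[ℝ] V →L[ℝ] ℝ) (J : V →L[ℝ] V) : Prop :=
  IsGreatest {k : ℕ | ∃ N : Submodule ℝ V,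
    (∀ v ∈ N, J v ∈ N) ∧ NegDefOn B N ∧ Module.finrank ℝ N = 2 * k} 1

/-- `J` is a complex structure for which the scalar product `B` is Hermitian, of complex
index one. -/
structure IsLorentzHermitian (B : V →L[ℝ] V →L[ℝ] ℝ) (J : V →L[ℝ] V) : Prop where
  sq : ∀ v, J (J v) = -v
  hermitian : ∀ u v, B (J u) (J v) = B u v
  index : HasComplexIndexOne B J

/-- The algebraic curvature identities of an indefinite Kaehler manifold, for a trilinear map
`R(X, Y)Z`, with `R(X, Y; Z, W) = B (R(X, Y)Z) W`. -/
structure IsKaehlerCurvature (B : V →L[ℝ] V →L[ℝ] ℝ) (J : V →L[ℝ] V)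
    (R : V →L[ℝ] V →L[ℝ] V →L[ℝ] V) : Prop where
  skew : ∀ X Y Z W, B (R X Y Z) W = -B (R Y X Z) W
  pair : ∀ X Y Z W, B (R X Y Z) W = B (R Z W X) Y
  complex : ∀ X Y Z W, B (R X Y (J Z)) W = -B (R X Y Z) (J W)

end LinearAlgebra

/-! ### The Levi-Civita connection of a metric on an open set of a vector space -/

section LeviCivita

variable {E : Type*} [NormedAddCommGroup E] [NormedSpace ℝ E]

/-- The Koszul covector `w ↦ (1/2) (∂_u g(v, w) + ∂_v g(u, w) - ∂_w g(u, v))`, that is, the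
Christoffel symbols of the first kind. -/
def koszul (g : E → E →L[ℝ] E →L[ℝ] ℝ) (x : E) : E →L[ℝ] E →L[ℝ] E →L[ℝ] ℝ :=
  (1 / 2 : ℝ) • (fderiv ℝ g x + (fderiv ℝ g x).flip
    - (ContinuousLinearMap.flipₗᵢ ℝ E E ℝ).toContinuousLinearEquiv.toContinuousLinearMap.comp
        (fderiv ℝ g x).flip)

theorem koszul_apply (g : E → E →L[ℝ] E →L[ℝ] ℝ) (x u v w : E) :
    koszul g x u v w =
      (1 / 2) * (fderiv ℝ g x u v w + fderiv ℝ g x v u w - fderiv ℝ g x w u v) := by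
  simp [koszul]

/-- The Christoffel symbols (of the second kind) `Γ_x(u, v)`, obtained by raising an index. -/
def christoffel (g : E → E →L[ℝ] E →L[ℝ] ℝ) (x : E) : E →L[ℝ] E →L[ℝ] E :=
  (ContinuousLinearMap.compL ℝ E (E →L[ℝ] ℝ) E (g x).inverse).comp (koszul g x)

theorem christoffel_apply (g : E → E →L[ℝ] E →L[ℝ] ℝ) (x u v : E) :
    christoffel g x u v = (g x).inverse (koszul g x u v) := rfl

/-- The Riemann curvature tensor `R_x(a, b)c` of the Levi-Civita connection of `g`. -/
def riemann (g : E → E →L[ℝ] E →L[ℝ] ℝ) (x : E) : E →L[ℝ] E →L[ℝ] E →L[ℝ] E :=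
  fderiv ℝ (christoffel g) x - (fderiv ℝ (christoffel g) x).flip
    + (ContinuousLinearMap.compL ℝ E E E).bilinearComp (christoffel g x) (christoffel g x)
    - ((ContinuousLinearMap.compL ℝ E E E).bilinearComp (christoffel g x) (christoffel g x)).flip

theorem riemann_apply (g : E → E →L[ℝ] E →L[ℝ] ℝ) (x a b c : E) :
    riemann g x a b c =
      fderiv ℝ (christoffel g) x a b c - fderiv ℝ (christoffel g) x b a c
        + christoffel g x a (christoffel g x b c) - christoffel g x b (christoffel g x a c) := by
  simp [riemann]

end LeviCivita

/-! ### The extrinsic geometry of a surface in a coordinate domain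

The bundle `T̃` along the surface (for an immersion `φ`, the pull-back of the tangent bundle of
the ambient space) is trivialised over an open set `dom` of the coordinate space `E`, with
fibre `W`. -/

/-- A metric `g` on `dom`, together with a bundle over `dom` with fibre `W`, which carries a
fibre metric `G`, endomorphisms `J`, a connection `d + θ`, and a bundle map `ι` from the tangent
bundle of `dom`. The laws are collected in `SurfaceData.IsLorentzKaehler`. -/
structure SurfaceData (E W : Type*) [NormedAddCommGroup E] [NormedSpace ℝ E]
    [NormedAddCommGroup W] [NormedSpace ℝ W] where
  dom : Set E
  g : E → E →L[ℝ] E →L[ℝ] ℝ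
  ι : E → E →L[ℝ] W
  G : E → W →L[ℝ] W →L[ℝ] ℝ
  J : E → W →L[ℝ] W
  θ : E → E →L[ℝ] W →L[ℝ] W

namespace SurfaceData

variable {E W : Type*} [NormedAddCommGroup E] [NormedSpace ℝ E]
  [NormedAddCommGroup W] [NormedSpace ℝ W] (S : SurfaceData E W)

/-- A Lorentz surface with a Lorentz Hermitian bundle along it, such that `ι` is isometric and the
connection `∇̃` of the bundle satisfies `∇̃ G = 0`, `∇̃ J = 0` and
`∇̃_X (ι Y) - ∇̃_Y (ι X) = ι [X, Y]`. -/
structure IsLorentzKaehler : Prop where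
  isOpen : IsOpen S.dom
  smooth_g : ContDiffOn ℝ ∞ S.g S.dom
  smooth_ι : ContDiffOn ℝ ∞ S.ι S.dom
  smooth_G : ContDiffOn ℝ ∞ S.G S.dom
  smooth_J : ContDiffOn ℝ ∞ S.J S.dom
  smooth_θ : ContDiffOn ℝ ∞ S.θ S.dom
  scalar_g : ∀ x ∈ S.dom, IsScalarProduct (S.g x)
  lorentz_g : ∀ x ∈ S.dom, IsLorentzian (S.g x)
  scalar_G : ∀ x ∈ S.dom, IsScalarProduct (S.G x)
  hermitian : ∀ x ∈ S.dom, IsLorentzHermitian (S.G x) (S.J x)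
  isometric : ∀ x ∈ S.dom, ∀ u v, S.G x (S.ι x u) (S.ι x v) = S.g x u v
  parallel_G : ∀ x ∈ S.dom, ∀ u a b,
    fderiv ℝ S.G x u a b = S.G x (S.θ x u a) b + S.G x a (S.θ x u b)
  parallel_J : ∀ x ∈ S.dom, ∀ u a,
    fderiv ℝ S.J x u a + S.θ x u (S.J x a) = S.J x (S.θ x u a)
  torsion_free : ∀ x ∈ S.dom, ∀ u v,
    fderiv ℝ S.ι x u v + S.θ x u (S.ι x v) = fderiv ℝ S.ι x v u + S.θ x v (S.ι x u)

/-- A vector field tangent to the surface, seen as a section of the bundle. -/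
def push (Y : E → E) : E → W := fun x => S.ι x (Y x)

/-- The connection `∇̃_X V` on sections of the bundle. -/
def covAmbient (X : E → E) (V : E → W) : E → W :=
  fun x => fderiv ℝ V x (X x) + S.θ x (X x) (V x)

/-- The Levi-Civita connection `∇_X Y` of `g`. -/
def nabla (X Y : E → E) : E → E :=
  fun x => fderiv ℝ Y x (X x) + christoffel S.g x (X x) (Y x)

/-- The tangential component of a section `V`: the vector field `T` with
`g(T, u) = G(V, ι u)` for all `u`. -/
def tangential (V : E → W) : E → E :=
  fun x => (S.g x).inverse ((S.G x (V x)).comp (S.ι x))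

/-- The normal component of a section. -/
def normal (V : E → W) : E → W := V - S.push (S.tangential V)

/-- The second fundamental form, from the formula of Gauss `∇̃_X Y = ∇_X Y + h(X, Y)`. -/
def h (X Y : E → E) : E → W := S.covAmbient X (S.push Y) - S.push (S.nabla X Y)

/-- The shape operator `A_ξ X`, from the formula of Weingarten `∇̃_X ξ = -A_ξ X + D_X ξ`. -/
def shape (ξ : E → W) (X : E → E) : E → E := -S.tangential (S.covAmbient X ξ)

/-- The normal connection `D_X ξ`, from the formula of Weingarten. -/
def normalCov (X : E → E) (ξ : E → W) : E → W := S.normal (S.covAmbient X ξ)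

/-- `(∇̄_X h)(Y, Z) = D_X h(Y, Z) - h(∇_X Y, Z) - h(Y, ∇_X Z)`. -/
def nablaBarH (X Y Z : E → E) : E → W :=
  S.normalCov X (S.h Y Z) - S.h (S.nabla X Y) Z - S.h Y (S.nabla X Z)

/-- The curvature `R(X, Y)Z` of the surface. -/
def curvature (X Y Z : E → E) : E → E :=
  S.nabla X (S.nabla Y Z) - S.nabla Y (S.nabla X Z) - S.nabla (VectorField.lieBracket ℝ X Y) Z

/-- The curvature `R^D(X, Y)ξ` of the normal connection. -/
def normalCurvature (X Y : E → E) (ξ : E → W) : E → W :=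
  S.normalCov X (S.normalCov Y ξ) - S.normalCov Y (S.normalCov X ξ)
    - S.normalCov (VectorField.lieBracket ℝ X Y) ξ

/-- A smooth vector field on the coordinate domain. -/
def IsField (X : E → E) : Prop := ContDiffOn ℝ ∞ X S.dom

/-- A smooth normal field on the coordinate domain. -/
def IsNormalField (ξ : E → W) : Prop :=
  ContDiffOn ℝ ∞ ξ S.dom ∧ ∀ y ∈ S.dom, ∀ u, S.G y (ξ y) (S.ι y u) = 0

/-- The equation of Gauss at `x`, with ambient curvature `Rt` at `x`. -/
def GaussAt (Rt : W →L[ℝ] W →L[ℝ] W →L[ℝ] W) (x : E) : Prop :=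
  ∀ X Y Z T : E → E, S.IsField X → S.IsField Y → S.IsField Z → S.IsField T →
    S.g x (S.curvature X Y Z x) (T x) =
      S.G x (Rt (S.push X x) (S.push Y x) (S.push Z x)) (S.push T x)
        + S.G x (S.h X T x) (S.h Y Z x) - S.G x (S.h X Z x) (S.h Y T x)

/-- The equation of Codazzi at `x`, with ambient curvature `Rt` at `x`; the left-hand side is the
normal component of `Rt(X, Y)Z`. -/
def CodazziAt (Rt : W →L[ℝ] W →L[ℝ] W →L[ℝ] W) (x : E) : Prop :=
  ∀ X Y Z : E → E, S.IsField X → S.IsField Y → S.IsField Z →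
    S.normal (fun y => Rt (S.push X y) (S.push Y y) (S.push Z y)) x =
      S.nablaBarH X Y Z x - S.nablaBarH Y X Z x

/-- The equation of Ricci at `x`, with ambient curvature `Rt` at `x`. -/
def RicciAt (Rt : W →L[ℝ] W →L[ℝ] W →L[ℝ] W) (x : E) : Prop :=
  ∀ X Y : E → E, ∀ ξ η : E → W, S.IsField X → S.IsField Y →
    S.IsNormalField ξ → S.IsNormalField η →
    S.G x (S.normalCurvature X Y ξ x) (η x) =
      S.G x (Rt (S.push X x) (S.push Y x) (ξ x)) (η x)
        + S.g x ((S.shape ξ (S.shape η X) - S.shape η (S.shape ξ X)) x) (Y x)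

end SurfaceData

/-! ### Manifolds -/

section Manifold

variable (E : Type*) [NormedAddCommGroup E] [NormedSpace ℝ E]
  (M : Type*) [TopologicalSpace M] [ChartedSpace E M] [IsManifold 𝓘(ℝ, E) ∞ M]

/-- A smooth pseudo-Riemannian metric. -/
structure SmoothMetric where
  inner (p : M) : TangentSpace 𝓘(ℝ, E) p →L[ℝ] TangentSpace 𝓘(ℝ, E) p →L[ℝ] ℝ
  isScalarProduct (p : M) : IsScalarProduct (inner p)
  contMDiff : ContMDiff 𝓘(ℝ, E) (𝓘(ℝ, E).prod 𝓘(ℝ, E →L[ℝ] E →L[ℝ] ℝ)) ∞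
    (fun p : M => Bundle.TotalSpace.mk' (E →L[ℝ] E →L[ℝ] ℝ)
      (E := fun p : M => TangentSpace 𝓘(ℝ, E) p →L[ℝ] TangentSpace 𝓘(ℝ, E) p →L[ℝ] ℝ)
      p (inner p))

/-- A smooth field of endomorphisms of the tangent spaces. -/
structure EndField where
  toFun (p : M) : TangentSpace 𝓘(ℝ, E) p →L[ℝ] TangentSpace 𝓘(ℝ, E) p
  contMDiff : ContMDiff 𝓘(ℝ, E) (𝓘(ℝ, E).prod 𝓘(ℝ, E →L[ℝ] E)) ∞
    (fun p : M => Bundle.TotalSpace.mk' (E →L[ℝ] E)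
      (E := fun p : M => TangentSpace 𝓘(ℝ, E) p →L[ℝ] TangentSpace 𝓘(ℝ, E) p)
      p (toFun p))

variable {E M}

/-- The coordinate frame of the chart `e`, at the point with coordinates `x`. -/
def chartFrame (e : OpenPartialHomeomorph M E) (x : E) :
    E →L[ℝ] TangentSpace 𝓘(ℝ, E) (e.symm x) :=
  mfderiv 𝓘(ℝ, E) 𝓘(ℝ, E) e.symm x

/-- The dual coframe of the chart `e`, at the point with coordinates `x`. -/
def chartCoframe (e : OpenPartialHomeomorph M E) (x : E) :
    TangentSpace 𝓘(ℝ, E) (e.symm x) →L[ℝ] E :=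
  mfderiv 𝓘(ℝ, E) 𝓘(ℝ, E) e (e.symm x)

/-- The coordinate expression of a metric in the chart `e`. -/
def SmoothMetric.inChart (g : SmoothMetric E M) (e : OpenPartialHomeomorph M E) (x : E) :
    E →L[ℝ] E →L[ℝ] ℝ :=
  ((chartFrame e x).precomp ℝ).comp ((g.inner (e.symm x)).comp (chartFrame e x))

theorem SmoothMetric.inChart_apply (g : SmoothMetric E M) (e : OpenPartialHomeomorph M E) (x u v : E) :
    g.inChart e x u v = g.inner (e.symm x) (chartFrame e x u) (chartFrame e x v) := rfl

/-- The coordinate expression of a field of endomorphisms in the chart `e`. -/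
def EndField.inChart (J : EndField E M) (e : OpenPartialHomeomorph M E) (x : E) : E →L[ℝ] E :=
  (chartCoframe e x).comp ((J.toFun (e.symm x)).comp (chartFrame e x))

/-- `∇ J = 0` for the Levi-Civita connection `∇` of `g`, expressed in all smooth charts. -/
def IsParallel (g : SmoothMetric E M) (J : EndField E M) : Prop :=
  ∀ e ∈ IsManifold.maximalAtlas 𝓘(ℝ, E) ∞ M, ∀ x ∈ e.target, ∀ u v : E,
    fderiv ℝ (J.inChart e) x u v + christoffel (g.inChart e) x u (J.inChart e x v)
      - J.inChart e x (christoffel (g.inChart e) x u v) = 0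

/-- The metric `g` and the almost complex structure `J` are those of an indefinite Kaehler
manifold of complex index one. -/
structure IsLorentzianKaehler (g : SmoothMetric E M) (J : EndField E M) : Prop where
  hermitian (p : M) : IsLorentzHermitian (g.inner p) (J.toFun p)
  parallel : IsParallel g J

variable {W : Type*} [NormedAddCommGroup W] [NormedSpace ℝ W]
  {N : Type*} [TopologicalSpace N] [ChartedSpace W N] [IsManifold 𝓘(ℝ, W) ∞ N]

/-- A smooth isometric immersion. -/
structure IsIsometricImmersion (g : SmoothMetric E M) (gt : SmoothMetric W N) (φ : M → N) : Prop where
  smooth : ContMDiff 𝓘(ℝ, E) 𝓘(ℝ, W) ∞ φ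
  immersion (p : M) : Function.Injective (mfderiv 𝓘(ℝ, E) 𝓘(ℝ, W) φ p)
  isometric (p : M) (u v : TangentSpace 𝓘(ℝ, E) p) :
    gt.inner (φ p) (mfderiv 𝓘(ℝ, E) 𝓘(ℝ, W) φ p u) (mfderiv 𝓘(ℝ, E) 𝓘(ℝ, W) φ p v)
      = g.inner p u v

/-- The coordinate expression of a map. -/
def mapInCharts (φ : M → N) (e : OpenPartialHomeomorph M E) (e' : OpenPartialHomeomorph N W) :
    E → W := fun x => e' (φ (e.symm x))

/-- The geometry of an immersed submanifold in charts `e` of `M` and `e'` of `N`: the bundle is the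
pull-back of the tangent bundle of `N`, trivialised by the coordinate frame of `e'`, with the
pull-backs of the metric, of `J` and of the Levi-Civita connection; `ι` is the differential of the
immersion. -/
def immersionData (g : SmoothMetric E M) (gt : SmoothMetric W N) (J : EndField W N) (φ : M → N)
    (e : OpenPartialHomeomorph M E) (e' : OpenPartialHomeomorph N W) : SurfaceData E W where
  dom := e.target ∩ e.symm ⁻¹' (φ ⁻¹' e'.source)
  g := g.inChart e
  ι := fderiv ℝ (mapInCharts φ e e')
  G := fun x => gt.inChart e' (mapInCharts φ e e' x)
  J := fun x => J.inChart e' (mapInCharts φ e e' x)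
  θ := fun x => (christoffel (gt.inChart e') (mapInCharts φ e e' x)).comp
    (fderiv ℝ (mapInCharts φ e e') x)

/-- A tensorial equation for the immersion `φ`, given in coordinates as a relation between the
geometry of the immersion and the ambient curvature tensor, holds at the point `p`. -/
def HoldsAt (eqn : SurfaceData E W → (W →L[ℝ] W →L[ℝ] W →L[ℝ] W) → E → Prop)
    (g : SmoothMetric E M) (gt : SmoothMetric W N) (J : EndField W N) (φ : M → N) (p : M) : Prop :=
  ∀ e ∈ IsManifold.maximalAtlas 𝓘(ℝ, E) ∞ M, p ∈ e.source →
    ∀ e' ∈ IsManifold.maximalAtlas 𝓘(ℝ, W) ∞ N, φ p ∈ e'.source →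
      eqn (immersionData g gt J φ e e')
        (riemann (gt.inChart e') (mapInCharts φ e e' (e p))) (e p)

end Manifold

end LorentzKaehler

end

noncomputable section

namespace LorentzKaehler

/-! ### Linear algebra of scalar products -/

section LinearAlgebra

variable {E W : Type*} [NormedAddCommGroup E] [NormedSpace ℝ E]
  [NormedAddCommGroup W] [NormedSpace ℝ W]

/-! Let `K` be the curvature of the connection in the formulas of Gauss and Weingarten. Splitting
second covariant derivatives into tangential and normal parts gives the Ricci equation for `K`
unconditionally (`ricci_connCurvature`). So it is enough to show that `Rt(X, Y)` and `K(X, Y)` agree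
on normal vectors.

The same splitting for tangent sections shows that Gauss and Codazzi amount to `Rt(X, Y)Z = K(X,
Y)Z` for tangent `Z` (`curvature_push_eq`). Both operators commute with `J`: for `Rt` by the Kaehler
symmetries, for `K` because `J` is parallel. Hence they also agree on `J` of the tangent plane.

A `J`-stable plane carries a metric that is definite or zero, so a Lorentz plane `T` is never a
complex line. Therefore `T + JT` is the whole four-dimensional fibre
(`exists_eq_add_complex_of_isLorentzian`), and the two operators coincide.

For an immersion, charts reduce everything to the coordinate statement. The Riemann tensor of the
ambient metric has the required symmetries by the first Bianchi identity and `∇̃J = 0`. -/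

theorem IsScalarProduct.isInvertible [FiniteDimensional ℝ E] {B : E →L[ℝ] E →L[ℝ] ℝ}
    (hB : IsScalarProduct B) : B.IsInvertible := by
  have hinj : Function.Injective (B : E →ₗ[ℝ] (E →L[ℝ] ℝ)) := by
    rw [← LinearMap.ker_eq_bot, LinearMap.ker_eq_bot']
    intro u hu
    exact hB.nondegenerate u fun v => by
      have : B u = 0 := hu
      simp [this]
  have hdim : Module.finrank ℝ E = Module.finrank ℝ (E →L[ℝ] ℝ) := by
    rw [← (LinearMap.toContinuousLinearMap (𝕜 := ℝ) (E := E) (F' := ℝ)).finrank_eq]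
    exact (Subspace.dual_finrank_eq (K := ℝ) (V := E)).symm
  refine ⟨(LinearEquiv.ofInjectiveOfFinrankEq
    (B : E →ₗ[ℝ] (E →L[ℝ] ℝ)) hinj hdim).toContinuousLinearEquiv, ?_⟩
  ext u v
  rfl

theorem IsScalarProduct.apply_inverse [FiniteDimensional ℝ E] {B : E →L[ℝ] E →L[ℝ] ℝ}
    (hB : IsScalarProduct B) (α : E →L[ℝ] ℝ) (w : E) : B (B.inverse α) w = α w := by
  rw [hB.isInvertible.self_apply_inverse]

theorem IsScalarProduct.ext {B : E →L[ℝ] E →L[ℝ] ℝ} (hB : IsScalarProduct B) {u v : E}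
    (h : ∀ w, B u w = B v w) : u = v :=
  sub_eq_zero.1 <| hB.nondegenerate _ fun w => by simp [h w]

/-- A Lorentz plane in a Hermitian space is not a complex line, and so it spans a complex
plane. -/
theorem exists_eq_add_complex_of_isLorentzian [FiniteDimensional ℝ E] [FiniteDimensional ℝ W]
    (hE : Module.finrank ℝ E = 2) (hW : Module.finrank ℝ W = 4)
    {g : E →L[ℝ] E →L[ℝ] ℝ} {G : W →L[ℝ] W →L[ℝ] ℝ} {J : W →L[ℝ] W} {P : E →L[ℝ] W}
    (hg : IsScalarProduct g) (hl : IsLorentzian g) (hG : IsScalarProduct G)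
    (hJ : ∀ v, J (J v) = -v) (hH : ∀ u v, G (J u) (J v) = G u v)
    (hP : ∀ u v, G (P u) (P v) = g u v) (w : W) : ∃ u v, w = P u + J (P v) := by
  have hPinj : ∀ u, P u = 0 → u = 0 := fun u hu => hg.nondegenerate u fun v => by
    rw [← hP, hu]; simp
  -- Source and target both have real dimension four, so injectivity suffices.
  let L : E × E →ₗ[ℝ] W :=
    (P : E →ₗ[ℝ] W).coprod ((J : W →ₗ[ℝ] W) ∘ₗ (P : E →ₗ[ℝ] W))
  have hL : ∀ u v, L (u, v) = P u + J (P v) := fun u v => rfl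
  have hinj : Function.Injective L := by
    rw [← LinearMap.ker_eq_bot, LinearMap.ker_eq_bot']
    rintro ⟨u, v⟩ huv
    rw [hL] at huv
    by_cases hv : v = 0
    · subst hv
      have : P u = 0 := by simpa using huv
      simp [hPinj u this]
    exfalso
    -- A kernel vector with `v ≠ 0` would make the image of `P` the complex line through `P v`, with
    -- orthogonal basis `P v`, `J (P v)` of equal square norms.
    have hu : P u = -J (P v) := eq_neg_of_add_eq_zero_left huv
    have hskew : G (J (P v)) (P v) = 0 := by
      have h1 := hH (J (P v)) (P v)
      rw [hJ, map_neg, _root_.neg_apply, hG.symm] at h1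
      linarith
    have huu : g u u = g v v := by
      rw [← hP, ← hP, hu]; simp [hH]
    have huv0 : g u v = 0 := by
      rw [← hP, hu]; simp [hskew]
    have hind : LinearIndependent ℝ ![u, v] := by
      rw [LinearIndependent.pair_iff]
      intro a b hab
      have h1 : a • P u + b • P v = 0 := by rw [← map_smul, ← map_smul, ← map_add, hab, map_zero]
      rw [hu] at h1
      have h2 : J (a • -J (P v) + b • P v) = 0 := by rw [h1, map_zero]
      simp only [map_add, map_smul, map_neg, hJ, neg_neg] at h2
      -- The relation reads `(b - aJ) P v = 0`; multiply by the conjugate `b + aJ`.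
      have h3 : (a ^ 2 + b ^ 2) • P v = 0 := by
        calc (a ^ 2 + b ^ 2) • P v
            = a • (a • P v + b • J (P v)) + b • (a • -J (P v) + b • P v) := by module
          _ = 0 := by rw [h1, h2]; simp
      have h4 : P v ≠ 0 := fun h => hv (hPinj v h)
      have h5 := (smul_eq_zero.1 h3).resolve_right h4
      constructor <;> nlinarith [sq_nonneg a, sq_nonneg b]
    have hspan : ∀ z : E, ∃ a b : ℝ, z = a • u + b • v := by
      intro z
      have htop := hind.span_eq_top_of_card_eq_finrank (by simp [hE])
      have hz : z ∈ Submodule.span ℝ (Set.range ![u, v]) := by rw [htop]; trivial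
      rw [Matrix.range_cons, Matrix.range_cons, Matrix.range_empty, Set.union_empty,
        Set.singleton_union, Submodule.mem_span_pair] at hz
      obtain ⟨a, b, h⟩ := hz
      exact ⟨a, b, h.symm⟩
    have hq : ∀ a b : ℝ, g (a • u + b • v) (a • u + b • v) = g v v * (a ^ 2 + b ^ 2) := by
      intro a b
      have hvu0 : g v u = 0 := by rw [hg.symm]; exact huv0
      simp only [map_add, map_smul, _root_.add_apply, _root_.smul_apply,
        smul_eq_mul, huv0, hvu0, huu]
      ring
    -- A multiple of a sum of two squares has index two or zero, never one.
    rcases lt_or_ge (g v v) 0 with hneg | hpos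
    · have h2 := hl.2 (show 2 ∈ _ from ⟨⊤, fun z _ hz => by
        obtain ⟨a, b, rfl⟩ := hspan z
        rw [hq]
        have : a ≠ 0 ∨ b ≠ 0 := by
          by_contra! h
          exact hz (by simp [h.1, h.2])
        have : 0 < a ^ 2 + b ^ 2 := by rcases this with h | h <;> positivity
        exact mul_neg_of_neg_of_pos hneg this, by rw [finrank_top, hE]⟩)
      omega
    · obtain ⟨N, hN, hN1⟩ := hl.1
      obtain ⟨z, hzN, hz⟩ : ∃ z ∈ N, z ≠ 0 := by
        apply Submodule.exists_mem_ne_zero_of_ne_bot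
        rintro rfl
        simp at hN1
      have := hN z hzN hz
      obtain ⟨a, b, rfl⟩ := hspan z
      rw [hq] at this
      nlinarith [mul_nonneg hpos (add_nonneg (sq_nonneg a) (sq_nonneg b))]
  have hsurj : Function.Surjective L :=
    (LinearMap.injective_iff_surjective_of_finrank_eq_finrank
      (by rw [Module.finrank_prod, hE, hW])).1 hinj
  obtain ⟨⟨u, v⟩, h⟩ := hsurj w
  exact ⟨u, v, by rw [← h, hL]⟩

end LinearAlgebra

/-! ### Connections on trivial bundles -/

section Connection

variable {E F W : Type*} [NormedAddCommGroup E] [NormedSpace ℝ E]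
  [NormedAddCommGroup F] [NormedSpace ℝ F] [NormedAddCommGroup W] [NormedSpace ℝ W]

theorem _root_.ContDiffOn.differentiableAt_of_isOpen {f : E → F} {s : Set E} {x : E}
    (hf : ContDiffOn ℝ ∞ f s) (hs : IsOpen s) (hx : x ∈ s) : DifferentiableAt ℝ f x :=
  (hf.contDiffAt (hs.mem_nhds hx)).differentiableAt (by simp)

theorem _root_.ContDiffOn.fderiv_infty {f : E → F} {s : Set E}
    (hf : ContDiffOn ℝ ∞ f s) (hs : IsOpen s) : ContDiffOn ℝ ∞ (fderiv ℝ f) s :=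
  hf.fderiv_of_isOpen hs (by simp)

theorem _root_.ContDiffOn.fderiv_fderiv_comm {f : E → F} {s : Set E} {x : E}
    (hf : ContDiffOn ℝ ∞ f s) (hs : IsOpen s) (hx : x ∈ s) (u v : E) :
    fderiv ℝ (fderiv ℝ f) x u v = fderiv ℝ (fderiv ℝ f) x v u :=
  (hf.contDiffAt (hs.mem_nhds hx)).isSymmSndFDerivAt
    (by rw [minSmoothness_of_isRCLikeNormedField]; exact ENat.LEInfty.out) u v

theorem fderiv_clm_apply_apply {A : E → F →L[ℝ] W} {V : E → F} {x : E}
    (hA : DifferentiableAt ℝ A x) (hV : DifferentiableAt ℝ V x) (u : E) :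
    fderiv ℝ (fun y => A y (V y)) x u = fderiv ℝ A x u (V x) + A x (fderiv ℝ V x u) := by
  rw [fderiv_clm_apply hA hV]
  simp [add_comm]

theorem fderiv_clm_apply_const {A : E → F →L[ℝ] W} {x : E}
    (hA : DifferentiableAt ℝ A x) (u : E) (v : F) :
    fderiv ℝ (fun y => A y v) x u = fderiv ℝ A x u v := by
  rw [fderiv_clm_apply_apply hA (by fun_prop)]
  simp

theorem fderiv_clm_apply_const₂ {F' : Type*} [NormedAddCommGroup F'] [NormedSpace ℝ F']
    {A : E → F →L[ℝ] F' →L[ℝ] W} {x : E} (hA : DifferentiableAt ℝ A x) (u : E) (v : F) (w : F') :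
    fderiv ℝ (fun y => A y v w) x u = fderiv ℝ A x u v w := by
  rw [fderiv_clm_apply_const (by fun_prop), fderiv_clm_apply_const hA]

/-- The curvature `K(u, v)w` of the connection `d + θ`. -/
def connCurvature (θ : E → E →L[ℝ] W →L[ℝ] W) (x u v : E) (w : W) : W :=
  fderiv ℝ θ x u v w - fderiv ℝ θ x v u w + θ x u (θ x v w) - θ x v (θ x u w)

theorem connCurvature_add (θ : E → E →L[ℝ] W →L[ℝ] W) (x u v : E) (a b : W) :
    connCurvature θ x u v (a + b) = connCurvature θ x u v a + connCurvature θ x u v b := by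
  simp only [connCurvature, map_add]
  abel

variable {θ : E → E →L[ℝ] W →L[ℝ] W} {s : Set E} {x : E}

/-- The curvature of a metric connection is skew-symmetric. -/
theorem connCurvature_skew_of_parallel {G : E → W →L[ℝ] W →L[ℝ] ℝ} (hs : IsOpen s) (hx : x ∈ s)
    (hθ : ContDiffOn ℝ ∞ θ s) (hG : ContDiffOn ℝ ∞ G s)
    (hp : ∀ y ∈ s, ∀ u a b, fderiv ℝ G y u a b = G y (θ y u a) b + G y a (θ y u b))
    (u v : E) (a b : W) :
    G x (connCurvature θ x u v a) b = -G x a (connCurvature θ x u v b) := by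
  have dθ := hθ.differentiableAt_of_isOpen hs hx
  have dG := hG.differentiableAt_of_isOpen hs hx
  have dG' := (hG.fderiv_infty hs).differentiableAt_of_isOpen hs hx
  -- Differentiate `∇̃G = 0`, which holds on a neighbourhood of `x`. The second derivative of `G` is
  -- symmetric, so antisymmetrising in `u, v` leaves only curvature terms.
  have key : ∀ u v, fderiv ℝ (fderiv ℝ G) x u v a b =
      fderiv ℝ G x u (θ x v a) b + G x (fderiv ℝ θ x u v a) b
        + (fderiv ℝ G x u a (θ x v b) + G x a (fderiv ℝ θ x u v b)) := by
    intro u v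
    have e : (fun y => fderiv ℝ G y v a b) =ᶠ[nhds x]
        fun y => G y (θ y v a) b + G y a (θ y v b) := by
      filter_upwards [hs.mem_nhds hx] with y hy using hp y hy v a b
    have h := congrArg (fun L => L u) (e.fderiv_eq (𝕜 := ℝ))
    have dc : ∀ w : W, DifferentiableAt ℝ (fun y => θ y v w) x := fun w => by fun_prop
    rwa [fderiv_clm_apply_const (by fun_prop), fderiv_clm_apply_const₂ dG',
      fderiv_fun_add (by fun_prop) (by fun_prop), _root_.add_apply,
      fderiv_clm_apply_const (by fun_prop), fderiv_clm_apply_apply dG (dc a), _root_.add_apply,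
      fderiv_clm_apply_apply (by fun_prop) (dc b), fderiv_clm_apply_const dG,
      fderiv_clm_apply_const₂ dθ, fderiv_clm_apply_const₂ dθ] at h
  have h1 := key u v
  have h2 := key v u
  rw [hG.fderiv_fderiv_comm hs hx u v, h2] at h1
  simp only [hp x hx] at h1
  simp only [connCurvature, map_add, map_sub, _root_.add_apply,
    _root_.sub_apply]
  linarith

/-- The curvature of a complex connection is complex linear. -/
theorem connCurvature_complex_of_parallel {J : E → W →L[ℝ] W} (hs : IsOpen s) (hx : x ∈ s)
    (hθ : ContDiffOn ℝ ∞ θ s) (hJ : ContDiffOn ℝ ∞ J s)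
    (hp : ∀ y ∈ s, ∀ u a, fderiv ℝ J y u a + θ y u (J y a) = J y (θ y u a))
    (u v : E) (a : W) :
    connCurvature θ x u v (J x a) = J x (connCurvature θ x u v a) := by
  have dθ := hθ.differentiableAt_of_isOpen hs hx
  have dJ := hJ.differentiableAt_of_isOpen hs hx
  have dJ' := (hJ.fderiv_infty hs).differentiableAt_of_isOpen hs hx
  -- As in the metric case: differentiate `∇̃J = 0` once and antisymmetrise.
  have key : ∀ u v, fderiv ℝ (fderiv ℝ J) x u v a + (fderiv ℝ θ x u v (J x a)
        + θ x v (fderiv ℝ J x u a))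
      = fderiv ℝ J x u (θ x v a) + J x (fderiv ℝ θ x u v a) := by
    intro u v
    have e : (fun y => fderiv ℝ J y v a + θ y v (J y a)) =ᶠ[nhds x]
        fun y => J y (θ y v a) := by
      filter_upwards [hs.mem_nhds hx] with y hy using hp y hy v a
    have h := congrArg (fun L => L u) (e.fderiv_eq (𝕜 := ℝ))
    have dc : ∀ w : W, DifferentiableAt ℝ (fun y => θ y v w) x := fun w => by fun_prop
    rwa [fderiv_fun_add (by fun_prop) (by fun_prop), _root_.add_apply,
      fderiv_clm_apply_const₂ dJ', fderiv_clm_apply_apply (by fun_prop) (by fun_prop),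
      fderiv_clm_apply_const dθ, fderiv_clm_apply_const dJ, fderiv_clm_apply_apply dJ (dc a),
      fderiv_clm_apply_const₂ dθ] at h
  have hp' : ∀ u a, fderiv ℝ J x u a = J x (θ x u a) - θ x u (J x a) := fun u a =>
    eq_sub_of_add_eq (hp x hx u a)
  have h1 := key u v
  have h2 := key v u
  rw [hJ.fderiv_fderiv_comm hs hx u v] at h1
  have h3 := congrArg₂ (· - ·) h1 h2
  simp only [hp', map_sub] at h3
  simp only [connCurvature, map_add, map_sub]
  rw [← sub_eq_zero] at h3 ⊢
  rw [← h3]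
  abel

end Connection

/-! ### The Levi-Civita connection -/

section LeviCivita

variable {E : Type*} [NormedAddCommGroup E] [NormedSpace ℝ E]
  {g : E → E →L[ℝ] E →L[ℝ] ℝ} {s : Set E} {x : E}

/-- Regarding Levi-Civita as the connection `d + Γ` gives access to the general results on
`connCurvature`. -/
theorem riemann_eq_connCurvature (g : E → E →L[ℝ] E →L[ℝ] ℝ) (x u v w : E) :
    riemann g x u v w = connCurvature (christoffel g) x u v w := riemann_apply g x u v w

theorem fderiv_metric_symm (hs : IsOpen s) (hx : x ∈ s) (hg : ContDiffOn ℝ ∞ g s)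
    (hsc : ∀ y ∈ s, IsScalarProduct (g y)) (u v w : E) :
    fderiv ℝ g x u v w = fderiv ℝ g x u w v := by
  have dg := hg.differentiableAt_of_isOpen hs hx
  have e : (fun y => g y v w) =ᶠ[nhds x] fun y => g y w v := by
    filter_upwards [hs.mem_nhds hx] with y hy using (hsc y hy).symm v w
  have h := congrArg (fun L => L u) (e.fderiv_eq (𝕜 := ℝ))
  rwa [fderiv_clm_apply_const₂ dg, fderiv_clm_apply_const₂ dg] at h

theorem christoffel_symm (hs : IsOpen s) (hx : x ∈ s) (hg : ContDiffOn ℝ ∞ g s)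
    (hsc : ∀ y ∈ s, IsScalarProduct (g y)) (u v : E) :
    christoffel g x u v = christoffel g x v u := by
  rw [christoffel_apply, christoffel_apply]
  congr 1
  ext w
  rw [koszul_apply, koszul_apply, fderiv_metric_symm hs hx hg hsc w u v]
  ring

variable [FiniteDimensional ℝ E]

theorem apply_christoffel (hsc : IsScalarProduct (g x)) (u v w : E) :
    g x (christoffel g x u v) w = koszul g x u v w := by
  rw [christoffel_apply, hsc.apply_inverse]

/-- Nondegeneracy gives invertibility in finite dimension, and inversion is smooth at invertible
operators. -/
theorem contDiffOn_inverse {A : E → E →L[ℝ] E →L[ℝ] ℝ} (hA : ContDiffOn ℝ ∞ A s)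
    (hsc : ∀ y ∈ s, IsScalarProduct (A y)) : ContDiffOn ℝ ∞ (fun y => (A y).inverse) s := by
  have : CompleteSpace E := FiniteDimensional.complete ℝ E
  intro y hy
  exact ((hsc y hy).isInvertible.contDiffAt_map_inverse).comp_contDiffWithinAt y (hA y hy)

theorem contDiffOn_christoffel (hs : IsOpen s) (hg : ContDiffOn ℝ ∞ g s)
    (hsc : ∀ y ∈ s, IsScalarProduct (g y)) : ContDiffOn ℝ ∞ (christoffel g) s := by
  have hd := hg.fderiv_infty hs
  have hi := contDiffOn_inverse hg hsc
  have hfl : ContDiffOn ℝ ∞ (fun y => (fderiv ℝ g y).flip) s :=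
    (ContinuousLinearMap.flipₗᵢ ℝ E E (E →L[ℝ] ℝ)).toContinuousLinearEquiv.contDiff.comp_contDiffOn
      hd
  have hk : ContDiffOn ℝ ∞ (koszul g) s :=
    ((hd.add hfl).sub (contDiffOn_const.clm_comp hfl)).const_smul (1 / 2 : ℝ)
  exact ((ContinuousLinearMap.compL ℝ E (E →L[ℝ] ℝ) E).contDiff.comp_contDiffOn hi).clm_comp hk

/-- The Levi-Civita connection is metric. -/
theorem fderiv_metric_eq (hs : IsOpen s) (hx : x ∈ s) (hg : ContDiffOn ℝ ∞ g s)
    (hsc : ∀ y ∈ s, IsScalarProduct (g y)) (u v w : E) :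
    fderiv ℝ g x u v w = g x (christoffel g x u v) w + g x v (christoffel g x u w) := by
  rw [(hsc x hx).symm v, apply_christoffel (hsc x hx), apply_christoffel (hsc x hx), koszul_apply,
    koszul_apply, fderiv_metric_symm hs hx hg hsc u w v]
  ring

/-- Since `Γ` is symmetric, both the derivative terms and the quadratic terms cancel in pairs in the
cyclic sum. -/
theorem riemann_bianchi (hs : IsOpen s) (hx : x ∈ s) (hg : ContDiffOn ℝ ∞ g s)
    (hsc : ∀ y ∈ s, IsScalarProduct (g y)) (u v w : E) :
    riemann g x u v w + riemann g x v w u + riemann g x w u v = 0 := by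
  have dc := (contDiffOn_christoffel hs hg hsc).differentiableAt_of_isOpen hs hx
  have hd : ∀ a b c, fderiv ℝ (christoffel g) x a b c = fderiv ℝ (christoffel g) x a c b := by
    intro a b c
    have e : (fun y => christoffel g y b c) =ᶠ[nhds x] fun y => christoffel g y c b := by
      filter_upwards [hs.mem_nhds hx] with y hy using christoffel_symm hs hy hg hsc b c
    have h := congrArg (fun L => L a) (e.fderiv_eq (𝕜 := ℝ))
    rwa [fderiv_clm_apply_const₂ dc, fderiv_clm_apply_const₂ dc] at h
  have hc := christoffel_symm hs hx hg hsc
  rw [riemann_apply, riemann_apply, riemann_apply, hd u w v, hd v u w, hd w v u, hc w v, hc u w,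
    hc v u]
  abel

/-- The curvature of an indefinite Kaehler metric has the Kaehler symmetries. -/
theorem isKaehlerCurvature_riemann {J : E → E →L[ℝ] E} (hs : IsOpen s) (hx : x ∈ s)
    (hg : ContDiffOn ℝ ∞ g s) (hsc : ∀ y ∈ s, IsScalarProduct (g y)) (hJ : ContDiffOn ℝ ∞ J s)
    (hsq : ∀ v, J x (J x v) = -v) (hh : ∀ u v, g x (J x u) (J x v) = g x u v)
    (hp : ∀ y ∈ s, ∀ u a,
      fderiv ℝ J y u a + christoffel g y u (J y a) = J y (christoffel g y u a)) :
    IsKaehlerCurvature (g x) (J x) (riemann g x) := by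
  have hc := contDiffOn_christoffel hs hg hsc
  have hskew : ∀ a b c d, g x (riemann g x a b c) d = -g x (riemann g x b a c) d := by
    intro a b c d
    rw [riemann_apply, riemann_apply, ← _root_.neg_apply, ← map_neg]
    congr 2
    abel
  have hskew' : ∀ a b c d, g x (riemann g x a b c) d = -g x (riemann g x a b d) c := by
    intro a b c d
    rw [riemann_eq_connCurvature, riemann_eq_connCurvature,
      connCurvature_skew_of_parallel hs hx hc hg (fun y hy => fderiv_metric_eq hs hy hg hsc), (hsc x hx).symm]
  have hb : ∀ a b c d, g x (riemann g x a b c) d + g x (riemann g x b c a) d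
      + g x (riemann g x c a b) d = 0 := by
    intro a b c d
    rw [← _root_.add_apply, ← _root_.add_apply, ← map_add, ← map_add,
      riemann_bianchi hs hx hg hsc]
    simp
  refine ⟨hskew, fun a b c d => ?_, fun a b c d => ?_⟩
  -- Pair symmetry is the classical linear consequence of four Bianchi identities and skewness in
  -- each pair.
  · linarith [hb a b c d, hb b c d a, hb c d a b, hb d a b c, hskew a b c d, hskew b c a d,
      hskew c a b d, hskew b c d a, hskew c d b a, hskew d b c a, hskew c d a b, hskew d a c b,
      hskew a c d b, hskew d a b c, hskew a b d c, hskew b d a c, hskew' a b c d, hskew' b c a d,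
      hskew' c a b d, hskew' b c d a, hskew' c d b a, hskew' d b c a, hskew' c d a b,
      hskew' d a c b, hskew' a c d b, hskew' d a b c, hskew' a b d c, hskew' b d a c]
  -- The curvature commutes with `J`, and an isometric `J` with `J² = -1` is skew-adjoint.
  · rw [riemann_eq_connCurvature, riemann_eq_connCurvature,
      connCurvature_complex_of_parallel hs hx hc hJ hp, ← hh _ (J x d), hsq]
    simp

end LeviCivita

/-! ### The fundamental equations -/

namespace SurfaceData

section Calculus

variable {E W : Type*} [NormedAddCommGroup E] [NormedSpace ℝ E]
  [NormedAddCommGroup W] [NormedSpace ℝ W] {S : SurfaceData E W} {x : E}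

/-! ### Formulas of Gauss and Weingarten. -/

theorem covAmbient_add (X : E → E) {V V' : E → W} (hV : DifferentiableAt ℝ V x)
    (hV' : DifferentiableAt ℝ V' x) :
    S.covAmbient X (V + V') x = S.covAmbient X V x + S.covAmbient X V' x := by
  simp only [covAmbient, fderiv_add hV hV', Pi.add_apply, map_add, _root_.add_apply]
  abel

theorem covAmbient_sub (X : E → E) {V V' : E → W} (hV : DifferentiableAt ℝ V x)
    (hV' : DifferentiableAt ℝ V' x) :
    S.covAmbient X (V - V') x = S.covAmbient X V x - S.covAmbient X V' x := by
  simp only [covAmbient, fderiv_sub hV hV', Pi.sub_apply, map_sub, _root_.sub_apply]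
  abel

/-- This is only the definition of `h`; that `h` is actually normal is the content of
`secondForm_normal`. -/
theorem covAmbient_push (X Y : E → E) :
    S.covAmbient X (S.push Y) = S.push (S.nabla X Y) + S.h X Y := by
  simp [h]

theorem covAmbient_eq_normalCov_sub (X : E → E) (ξ : E → W) :
    S.covAmbient X ξ = S.normalCov X ξ - S.push (S.shape ξ X) := by
  ext y
  simp [normalCov, normal, shape, push]

theorem covAmbient_eq_push_tangential_add (X : E → E) (V : E → W) :
    S.covAmbient X V = S.push (S.tangential (S.covAmbient X V)) + S.normalCov X V := by
  simp [normalCov, normal]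

/-- The second fundamental form as a tensor. -/
def secondForm (S : SurfaceData E W) (x u v : E) : W :=
  fderiv ℝ S.ι x u v + S.θ x u (S.ι x v) - S.ι x (christoffel S.g x u v)

theorem h_sub_left (X X' Y : E → E) : S.h (X - X') Y x = S.h X Y x - S.h X' Y x := by
  simp only [h, covAmbient, push, nabla, Pi.sub_apply, map_add, map_sub, _root_.sub_apply]
  abel

namespace IsLorentzKaehler

theorem contDiffOn_push (hS : S.IsLorentzKaehler)
    {Y : E → E} (hY : S.IsField Y) : ContDiffOn ℝ ∞ (S.push Y) S.dom :=
  hS.smooth_ι.clm_apply hY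

theorem contDiffOn_covAmbient (hS : S.IsLorentzKaehler) {X : E → E} {V : E → W} (hX : S.IsField X)
    (hV : ContDiffOn ℝ ∞ V S.dom) : ContDiffOn ℝ ∞ (S.covAmbient X V) S.dom :=
  ((hV.fderiv_infty hS.isOpen).clm_apply hX).add ((hS.smooth_θ.clm_apply hX).clm_apply hV)

/-- The second derivatives of `V` cancel by symmetry and the derivatives of `X` and `Y` are absorbed
by the bracket, leaving a term of order zero in `V`. -/
theorem covAmbient_commutator (hS : S.IsLorentzKaehler)
    (hx : x ∈ S.dom) {X Y : E → E} {V : E → W} (hX : S.IsField X)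
    (hY : S.IsField Y) (hV : ContDiffOn ℝ ∞ V S.dom) :
    S.covAmbient X (S.covAmbient Y V) x - S.covAmbient Y (S.covAmbient X V) x
        - S.covAmbient (VectorField.lieBracket ℝ X Y) V x
      = connCurvature S.θ x (X x) (Y x) (V x) := by
  have dθ := hS.smooth_θ.differentiableAt_of_isOpen hS.isOpen hx
  have dV := hV.differentiableAt_of_isOpen hS.isOpen hx
  have dV' := (hV.fderiv_infty hS.isOpen).differentiableAt_of_isOpen hS.isOpen hx
  have key : ∀ (Z : E → E) (u : E), S.IsField Z → fderiv ℝ (S.covAmbient Z V) x u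
      = fderiv ℝ (fderiv ℝ V) x u (Z x) + fderiv ℝ V x (fderiv ℝ Z x u)
        + (fderiv ℝ S.θ x u (Z x) (V x) + S.θ x (fderiv ℝ Z x u) (V x)
          + S.θ x (Z x) (fderiv ℝ V x u)) := by
    intro Z u hZ
    have dZ := hZ.differentiableAt_of_isOpen hS.isOpen hx
    have e : S.covAmbient Z V = fun y => fderiv ℝ V y (Z y) + S.θ y (Z y) (V y) := rfl
    rw [e, fderiv_fun_add (by fun_prop) (by fun_prop), _root_.add_apply,
      fderiv_clm_apply_apply dV' dZ, fderiv_clm_apply_apply (by fun_prop) dV,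
      fderiv_clm_apply_apply dθ dZ, _root_.add_apply]
  have e : ∀ (Z : E → E) (V : E → W), S.covAmbient Z V x = fderiv ℝ V x (Z x) + S.θ x (Z x) (V x) :=
    fun _ _ => rfl
  rw [e X (S.covAmbient Y V), e Y (S.covAmbient X V), e _ V, key Y _ hY, key X _ hX, e, e,
    hV.fderiv_fderiv_comm hS.isOpen hx (Y x) (X x), VectorField.lieBracket]
  simp only [connCurvature, map_add, map_sub, _root_.sub_apply]
  abel

/-- The connection of the bundle is metric, for sections. -/
theorem fderiv_metric_apply (hS : S.IsLorentzKaehler) (hx : x ∈ S.dom) (X : E → E) {V V' : E → W}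
    (hV : ContDiffOn ℝ ∞ V S.dom) (hV' : ContDiffOn ℝ ∞ V' S.dom) :
    fderiv ℝ (fun y => S.G y (V y) (V' y)) x (X x) =
      S.G x (S.covAmbient X V x) (V' x) + S.G x (V x) (S.covAmbient X V' x) := by
  have dG := hS.smooth_G.differentiableAt_of_isOpen hS.isOpen hx
  have dV := hV.differentiableAt_of_isOpen hS.isOpen hx
  have dV' := hV'.differentiableAt_of_isOpen hS.isOpen hx
  rw [fderiv_clm_apply_apply (by fun_prop) dV', fderiv_clm_apply_apply dG dV, _root_.add_apply,
    hS.parallel_G x hx]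
  simp only [covAmbient, map_add, _root_.add_apply]
  ring

/-- Differentiate `G(V, V') = 0`. Applied to a normal and a tangent section, it moves the derivative
from one to the other. -/
theorem metric_covAmbient_eq_neg (hS : S.IsLorentzKaehler)
    (hx : x ∈ S.dom) (X : E → E) {V V' : E → W}
    (hV : ContDiffOn ℝ ∞ V S.dom) (hV' : ContDiffOn ℝ ∞ V' S.dom)
    (h0 : ∀ y ∈ S.dom, S.G y (V y) (V' y) = 0) :
    S.G x (S.covAmbient X V x) (V' x) = -S.G x (V x) (S.covAmbient X V' x) := by
  have e : (fun y => S.G y (V y) (V' y)) =ᶠ[nhds x] fun _ => 0 := by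
    filter_upwards [hS.isOpen.mem_nhds hx] with y hy using h0 y hy
  have h1 := hS.fderiv_metric_apply hx X hV hV'
  rw [e.fderiv_eq] at h1
  simp only [fderiv_fun_const, Pi.zero_apply, _root_.zero_apply] at h1
  linarith

/-- Tensoriality: the derivative of `Y` enters `∇̃_X Y` and `∇_X Y` identically and cancels. -/
theorem h_eq_secondForm (hS : S.IsLorentzKaehler)
    (hx : x ∈ S.dom) (X : E → E) {Y : E → E} (hY : S.IsField Y) :
    S.h X Y x = S.secondForm x (X x) (Y x) := by
  have dι := hS.smooth_ι.differentiableAt_of_isOpen hS.isOpen hx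
  have dY := hY.differentiableAt_of_isOpen hS.isOpen hx
  have e : S.push Y = fun y => S.ι y (Y y) := rfl
  simp only [h, Pi.sub_apply, covAmbient, secondForm]
  rw [e, fderiv_clm_apply_apply dι dY]
  simp only [push, nabla, map_add]
  abel

theorem secondForm_symm (hS : S.IsLorentzKaehler) (hx : x ∈ S.dom) (u v : E) :
    S.secondForm x u v = S.secondForm x v u := by
  rw [secondForm, secondForm, hS.torsion_free x hx u v,
    christoffel_symm hS.isOpen hx hS.smooth_g hS.scalar_g u v]

theorem metric_normal_apply (hS : S.IsLorentzKaehler)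
    (hx : x ∈ S.dom) (V : E → W) {η : E → W} (hη : S.IsNormalField η) :
    S.G x (S.normal V x) (η x) = S.G x (V x) (η x) := by
  rw [normal, Pi.sub_apply, map_sub, _root_.sub_apply, push, (hS.scalar_G x hx).symm (S.ι x _),
    hη.2 x hx, sub_zero]

/-- `∇` is torsion-free, and `h` sees only the value at `x` of its first argument. This matches the
bracket term of the curvature with the antisymmetrised `nablaBarH`. -/
theorem h_lieBracket (hS : S.IsLorentzKaehler) (hx : x ∈ S.dom) (X Y Z : E → E) :
    S.h (VectorField.lieBracket ℝ X Y) Z x = S.h (S.nabla X Y) Z x - S.h (S.nabla Y X) Z x := by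
  have e : VectorField.lieBracket ℝ X Y x = (S.nabla X Y - S.nabla Y X) x := by
    simp only [nabla, VectorField.lieBracket, Pi.sub_apply,
      christoffel_symm hS.isOpen hx hS.smooth_g hS.scalar_g (X x) (Y x)]
    abel
  rw [← h_sub_left]
  simp only [h, covAmbient, push, nabla, Pi.sub_apply, e]

/-! ### Normality of `h` and the three fundamental equations. -/

variable [FiniteDimensional ℝ E]

/-- Uniqueness of the Levi-Civita connection: the tangential part of `∇̃` along the surface is
metric and torsion-free, so Koszul's formula identifies it with `∇`. -/
theorem secondForm_normal (hS : S.IsLorentzKaehler) (hx : x ∈ S.dom) (u v w : E) :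
    S.G x (S.secondForm x u v) (S.ι x w) = 0 := by
  have dι := hS.smooth_ι.differentiableAt_of_isOpen hS.isOpen hx
  have dg := hS.smooth_g.differentiableAt_of_isOpen hS.isOpen hx
  let B : E → E → E → ℝ := fun a b c =>
    S.G x (fderiv ℝ S.ι x a b + S.θ x a (S.ι x b)) (S.ι x c)
  have hB1 : ∀ a b c, B a b c = B b a c := fun a b c => by
    simp only [B, hS.torsion_free x hx a b]
  have hB2 : ∀ a b c, fderiv ℝ S.g x a b c = B a b c + B a c b := by
    intro a b c
    have e : (fun y => S.g y b c) =ᶠ[nhds x] fun y => S.G y (S.ι y b) (S.ι y c) := by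
      filter_upwards [hS.isOpen.mem_nhds hx] with y hy using (hS.isometric y hy b c).symm
    have h1 := congrArg (fun L => L a) (e.fderiv_eq (𝕜 := ℝ))
    rw [fderiv_clm_apply_const₂ dg, hS.fderiv_metric_apply hx (fun _ => a)
      (hS.smooth_ι.clm_apply contDiffOn_const) (hS.smooth_ι.clm_apply contDiffOn_const)] at h1
    simp only [covAmbient, fderiv_clm_apply_const dι] at h1
    rw [h1, (hS.scalar_G x hx).symm (S.ι x b)]
  have hk : koszul S.g x u v w = B u v w := by
    rw [koszul_apply, hB2, hB2, hB2, hB1 v u w, hB1 w u v, hB1 w v u]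
    ring
  rw [secondForm, map_sub, _root_.sub_apply, hS.isometric x hx,
    apply_christoffel (hS.scalar_g x hx), hk, sub_self]

theorem h_normal (hS : S.IsLorentzKaehler)
    (hx : x ∈ S.dom) (X : E → E) {Y : E → E} (hY : S.IsField Y) (w : E) :
    S.G x (S.h X Y x) (S.ι x w) = 0 := by
  rw [hS.h_eq_secondForm hx X hY, hS.secondForm_normal hx]

theorem contDiffOn_nabla (hS : S.IsLorentzKaehler)
    {X Y : E → E} (hX : S.IsField X) (hY : S.IsField Y) :
    S.IsField (S.nabla X Y) :=
  ((hY.fderiv_infty hS.isOpen).clm_apply hX).add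
    (((contDiffOn_christoffel hS.isOpen hS.smooth_g hS.scalar_g).clm_apply hX).clm_apply hY)

theorem contDiffOn_h (hS : S.IsLorentzKaehler) {X Y : E → E} (hX : S.IsField X) (hY : S.IsField Y) :
    ContDiffOn ℝ ∞ (S.h X Y) S.dom :=
  (hS.contDiffOn_covAmbient hX (hS.contDiffOn_push hY)).sub
    (hS.contDiffOn_push (hS.contDiffOn_nabla hX hY))

theorem contDiffOn_tangential (hS : S.IsLorentzKaehler) {V : E → W} (hV : ContDiffOn ℝ ∞ V S.dom) :
    S.IsField (S.tangential V) :=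
  (contDiffOn_inverse hS.smooth_g hS.scalar_g).clm_apply
    ((hS.smooth_G.clm_apply hV).clm_comp hS.smooth_ι)

theorem contDiffOn_shape (hS : S.IsLorentzKaehler)
    {ξ : E → W} {X : E → E} (hξ : ContDiffOn ℝ ∞ ξ S.dom)
    (hX : S.IsField X) : S.IsField (S.shape ξ X) :=
  (hS.contDiffOn_tangential (hS.contDiffOn_covAmbient hX hξ)).neg

theorem contDiffOn_normalCov (hS : S.IsLorentzKaehler)
    {ξ : E → W} {X : E → E} (hξ : ContDiffOn ℝ ∞ ξ S.dom)
    (hX : S.IsField X) : ContDiffOn ℝ ∞ (S.normalCov X ξ) S.dom :=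
  (hS.contDiffOn_covAmbient hX hξ).sub
    (hS.contDiffOn_push (hS.contDiffOn_tangential (hS.contDiffOn_covAmbient hX hξ)))

theorem metric_tangential (hS : S.IsLorentzKaehler) (hx : x ∈ S.dom) (V : E → W) (w : E) :
    S.g x (S.tangential V x) w = S.G x (V x) (S.ι x w) := by
  rw [tangential, (hS.scalar_g x hx).apply_inverse]
  rfl

/-- The shape operator is dual to the second fundamental form. -/
theorem metric_shape (hS : S.IsLorentzKaehler)
    (hx : x ∈ S.dom) {ξ : E → W} (hξ : S.IsNormalField ξ) (X : E → E)
    {Y : E → E} (hY : S.IsField Y) :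
    S.g x (S.shape ξ X x) (Y x) = S.G x (ξ x) (S.h X Y x) := by
  have h1 := hS.metric_covAmbient_eq_neg hx X hξ.1 (hS.contDiffOn_push hY)
    (fun y hy => hξ.2 y hy (Y y))
  rw [covAmbient_push, Pi.add_apply, map_add] at h1
  simp only [push] at h1
  rw [hξ.2 x hx, zero_add] at h1
  rw [shape, Pi.neg_apply, map_neg, _root_.neg_apply, hS.metric_tangential hx, h1, neg_neg]

/-- The equations of Gauss and Codazzi determine the ambient curvature on the tangent planes. -/
theorem curvature_push_eq (hS : S.IsLorentzKaehler)
    (hx : x ∈ S.dom) {Rt : W →L[ℝ] W →L[ℝ] W →L[ℝ] W}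
    (hG : S.GaussAt Rt x) (hC : S.CodazziAt Rt x) {X Y Z : E → E} (hX : S.IsField X)
    (hY : S.IsField Y) (hZ : S.IsField Z) :
    Rt (S.push X x) (S.push Y x) (S.push Z x)
      = connCurvature S.θ x (X x) (Y x) (S.push Z x) := by
  have hcov : ∀ X Y : E → E, S.IsField X → S.IsField Y →
      S.covAmbient X (S.covAmbient Y (S.push Z)) x
        = S.ι x (S.nabla X (S.nabla Y Z) x) + S.h X (S.nabla Y Z) x
          + (S.ι x (S.tangential (S.covAmbient X (S.h Y Z)) x) + S.normalCov X (S.h Y Z) x) := by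
    intro X Y hX hY
    have hn := hS.contDiffOn_nabla hY hZ
    rw [covAmbient_push Y Z, covAmbient_add X
      ((hS.contDiffOn_push hn).differentiableAt_of_isOpen hS.isOpen hx)
      ((hS.contDiffOn_h hY hZ).differentiableAt_of_isOpen hS.isOpen hx), covAmbient_push,
      congrFun (covAmbient_eq_push_tangential_add X (S.h Y Z)) x]
    rfl
  -- The tangential part of `∇̃_X h(Y, Z)` produces the quadratic terms of the Gauss equation.
  have hsh : ∀ (X Y T : E → E), S.IsField X → S.IsField Y → S.IsField T →
      S.g x (S.tangential (S.covAmbient X (S.h Y Z)) x) (T x)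
        = -S.G x (S.h X T x) (S.h Y Z x) := by
    intro X Y T hX hY hT
    have h1 := hS.metric_covAmbient_eq_neg hx X (hS.contDiffOn_h hY hZ) (hS.contDiffOn_push hT)
      (fun y hy => hS.h_normal hy Y hZ (T y))
    rw [covAmbient_push, Pi.add_apply, map_add] at h1
    simp only [push] at h1
    rw [hS.h_normal hx Y hZ, zero_add, (hS.scalar_G x hx).symm (S.h Y Z x)] at h1
    rw [hS.metric_tangential hx, h1]
  have hK := hS.covAmbient_commutator hx hX hY (hS.contDiffOn_push hZ)
  rw [hcov X Y hX hY, hcov Y X hY hX, covAmbient_push, Pi.add_apply, push] at hK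
  have hCod := hC X Y Z hX hY hZ
  have htan : S.tangential (fun y => Rt (S.push X y) (S.push Y y) (S.push Z y)) x
      = S.curvature X Y Z x + S.tangential (S.covAmbient X (S.h Y Z)) x
        - S.tangential (S.covAmbient Y (S.h X Z)) x := by
    refine (hS.scalar_g x hx).ext fun t => ?_
    have hT : S.IsField fun _ => t := contDiffOn_const
    have h1 := hG X Y Z (fun _ => t) hX hY hZ hT
    have h2 := hsh X Y _ hX hY hT
    have h3 := hsh Y X _ hY hX hT
    rw [hS.metric_tangential hx]
    simp only [map_add, map_sub, _root_.add_apply, _root_.sub_apply]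
    simp only [push] at h1 ⊢
    rw [(hS.scalar_G x hx).symm (S.h X Z x)] at h1
    linarith
  -- Gauss has fixed the tangential component and Codazzi fixes the normal one.
  have hdec : Rt (S.push X x) (S.push Y x) (S.push Z x)
      = S.ι x (S.tangential (fun y => Rt (S.push X y) (S.push Y y) (S.push Z y)) x)
        + S.normal (fun y => Rt (S.push X y) (S.push Y y) (S.push Z y)) x := by
    simp [normal, push]
  rw [hdec, htan, hCod]
  simp only [push] at hK ⊢
  rw [← hK]
  simp only [nablaBarH, curvature, Pi.sub_apply, map_add, map_sub, hS.h_lieBracket hx X Y Z]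
  abel

/-- The equation of Ricci for the curvature of the connection `∇̃`. -/
theorem ricci_connCurvature (hS : S.IsLorentzKaehler)
    (hx : x ∈ S.dom) {X Y : E → E} {ξ η : E → W} (hX : S.IsField X)
    (hY : S.IsField Y) (hξ : S.IsNormalField ξ) (hη : S.IsNormalField η) :
    S.G x (S.normalCurvature X Y ξ x) (η x) =
      S.G x (connCurvature S.θ x (X x) (Y x) (ξ x)) (η x)
        + S.g x ((S.shape ξ (S.shape η X) - S.shape η (S.shape ξ X)) x) (Y x) := by
  -- Differentiating the tangential part `-A_ξ Y` of `∇̃_Y ξ` gives the normal term `-h(X, A_ξ Y)`,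
  -- whose product with `η` is `-g(A_η X, A_ξ Y)`.
  have hcov : ∀ X Y : E → E, S.IsField X → S.IsField Y →
      S.G x (S.covAmbient X (S.covAmbient Y ξ) x) (η x)
        = S.G x (S.normalCov X (S.normalCov Y ξ) x) (η x)
          - S.g x (S.shape η X x) (S.shape ξ Y x) := by
    intro X Y hX hY
    have hsh := hS.contDiffOn_shape hξ.1 hY
    rw [covAmbient_eq_normalCov_sub Y ξ, covAmbient_sub X
      ((hS.contDiffOn_normalCov hξ.1 hY).differentiableAt_of_isOpen hS.isOpen hx)
      ((hS.contDiffOn_push hsh).differentiableAt_of_isOpen hS.isOpen hx), covAmbient_push,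
      hS.metric_shape hx hη X hsh,
      show S.normalCov X (S.normalCov Y ξ) = S.normal (S.covAmbient X (S.normalCov Y ξ)) from rfl,
      hS.metric_normal_apply hx _ hη]
    simp only [Pi.add_apply, map_add, map_sub, _root_.sub_apply, _root_.add_apply, push]
    rw [(hS.scalar_G x hx).symm (S.ι x _) (η x), hη.2 x hx, (hS.scalar_G x hx).symm (η x)]
    ring
  -- Self-adjointness of `A_ξ`, from the symmetry of `h`; it turns these products into the
  -- commutator of shape operators.
  have hdual : ∀ {ξ η : E → W} (X Y : E → E), S.IsField X → S.IsField Y → S.IsNormalField ξ →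
      S.IsNormalField η →
      S.g x (S.shape ξ (S.shape η X) x) (Y x) = S.g x (S.shape η X x) (S.shape ξ Y x) := by
    intro ξ η X Y hX hY hξ hη
    have hsh := hS.contDiffOn_shape hη.1 hX
    rw [hS.metric_shape hx hξ _ hY, hS.h_eq_secondForm hx _ hY, hS.secondForm_symm hx,
      ← hS.h_eq_secondForm hx Y hsh, ← hS.metric_shape hx hξ Y hsh, (hS.scalar_g x hx).symm]
  have hK := hS.covAmbient_commutator hx hX hY hξ.1
  rw [← hK]
  simp only [normalCurvature, Pi.sub_apply, map_sub, _root_.sub_apply]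
  rw [hcov X Y hX hY, hcov Y X hY hX, hdual X Y hX hY hξ hη, hdual X Y hX hY hη hξ,
    show S.normalCov (VectorField.lieBracket ℝ X Y) ξ
      = S.normal (S.covAmbient (VectorField.lieBracket ℝ X Y) ξ) from rfl,
    hS.metric_normal_apply hx _ hη, (hS.scalar_g x hx).symm (S.shape η Y x)]
  ring

/-- The equation of Ricci is a consequence of the equations of Gauss and Codazzi. -/
theorem ricciAt [FiniteDimensional ℝ W] (hS : S.IsLorentzKaehler) (hE : Module.finrank ℝ E = 2)
    (hW : Module.finrank ℝ W = 4) (hx : x ∈ S.dom) {Rt : W →L[ℝ] W →L[ℝ] W →L[ℝ] W}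
    (hR : IsKaehlerCurvature (S.G x) (S.J x) Rt) (hG : S.GaussAt Rt x) (hC : S.CodazziAt Rt x) :
    S.RicciAt Rt x := by
  intro X Y ξ η hX hY hξ hη
  have hH := hS.hermitian x hx
  have htan : ∀ u, Rt (S.push X x) (S.push Y x) (S.ι x u)
      = connCurvature S.θ x (X x) (Y x) (S.ι x u) := fun u =>
    hS.curvature_push_eq hx hG hC hX hY (Z := fun _ => u) contDiffOn_const
  -- Since `J` is skew-adjoint and `G` nondegenerate, the third Kaehler identity says that `Rt(X,
  -- Y)` is complex linear.
  have hRJ : ∀ w, Rt (S.push X x) (S.push Y x) (S.J x w)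
      = S.J x (Rt (S.push X x) (S.push Y x) w) := fun w =>
    (hS.scalar_G x hx).ext fun z => by
      rw [hR.complex, ← hH.hermitian _ z, ← hH.hermitian _ (S.J x z), hH.sq, ← hH.hermitian]
      simp [hH.sq]
  obtain ⟨u, v, huv⟩ := exists_eq_add_complex_of_isLorentzian hE hW (hS.scalar_g x hx)
    (hS.lorentz_g x hx) (hS.scalar_G x hx) hH.sq hH.hermitian (hS.isometric x hx) (ξ x)
  have hξ' : Rt (S.push X x) (S.push Y x) (ξ x) = connCurvature S.θ x (X x) (Y x) (ξ x) := by
    rw [huv, connCurvature_add, map_add, hRJ, htan, htan, connCurvature_complex_of_parallel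
      hS.isOpen hx hS.smooth_θ hS.smooth_J hS.parallel_J]
  rw [hξ', hS.ricci_connCurvature hx hX hY hξ hη]

end IsLorentzKaehler

end Calculus

end SurfaceData

/-! ### Transport of scalar products -/

section Transport

variable {V V' : Type*} [AddCommGroup V] [Module ℝ V] [TopologicalSpace V]
  [AddCommGroup V'] [Module ℝ V'] [TopologicalSpace V']
  {B : V →L[ℝ] V →L[ℝ] ℝ} {B' : V' →L[ℝ] V' →L[ℝ] ℝ} {J : V →L[ℝ] V} {J' : V' →L[ℝ] V'}

/-- This and the next lemmas serve to carry pointwise conditions from a tangent space to the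
coordinate space along a chart coframe. -/
theorem NegDefOn.map (Φ : V ≃L[ℝ] V') (hB : ∀ u v, B' (Φ u) (Φ v) = B u v) {N : Submodule ℝ V}
    (hN : NegDefOn B N) : NegDefOn B' (N.map (Φ.toLinearEquiv : V →ₗ[ℝ] V')) := by
  rintro _ ⟨v, hv, rfl⟩ h0
  have : B' (Φ v) (Φ v) < 0 := by
    rw [hB]
    exact hN v hv fun h => h0 (by simp [h])
  exact this

theorem IsScalarProduct.map (Φ : V ≃L[ℝ] V') (hB : ∀ u v, B' (Φ u) (Φ v) = B u v)
    (h : IsScalarProduct B) : IsScalarProduct B' where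
  symm u v := by
    obtain ⟨u, rfl⟩ := Φ.surjective u
    obtain ⟨v, rfl⟩ := Φ.surjective v
    rw [hB, hB, h.symm]
  nondegenerate u hu := by
    obtain ⟨u, rfl⟩ := Φ.surjective u
    rw [h.nondegenerate u fun v => by rw [← hB, hu], map_zero]

theorem IsLorentzian.map (Φ : V ≃L[ℝ] V') (hB : ∀ u v, B' (Φ u) (Φ v) = B u v)
    (h : IsLorentzian B) : IsLorentzian B' := by
  constructor
  · obtain ⟨N, hN, h1⟩ := h.1
    exact ⟨_, hN.map Φ hB, by rw [LinearEquiv.finrank_map_eq, h1]⟩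
  · rintro k ⟨N, hN, rfl⟩
    -- Maximality is transported by pulling a competing subspace back.
    exact h.2 ⟨_, hN.map Φ.symm (fun u v => by simp [← hB]), by rw [LinearEquiv.finrank_map_eq]⟩

theorem IsLorentzHermitian.map (Φ : V ≃L[ℝ] V') (hB : ∀ u v, B' (Φ u) (Φ v) = B u v)
    (hJ : ∀ v, J' (Φ v) = Φ (J v)) (h : IsLorentzHermitian B J) : IsLorentzHermitian B' J' where
  sq v := by
    obtain ⟨v, rfl⟩ := Φ.surjective v
    rw [hJ, hJ, h.sq, map_neg]
  hermitian u v := by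
    obtain ⟨u, rfl⟩ := Φ.surjective u
    obtain ⟨v, rfl⟩ := Φ.surjective v
    rw [hJ, hJ, hB, hB, h.hermitian]
  index := by
    constructor
    · obtain ⟨N, hN, h1, h2⟩ := h.index.1
      refine ⟨_, ?_, h1.map Φ hB, by rw [LinearEquiv.finrank_map_eq, h2]⟩
      rintro _ ⟨v, hv, rfl⟩
      exact ⟨J v, hN v hv, (hJ v).symm⟩
    · rintro k ⟨N, hN, h1, h2⟩
      refine h.index.2 ⟨_, ?_, h1.map Φ.symm (fun u v => by simp [← hB]),
        by rw [LinearEquiv.finrank_map_eq, h2]⟩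
      rintro _ ⟨v, hv, rfl⟩
      refine ⟨J' v, hN v hv, Φ.injective ?_⟩
      have h3 := hJ (Φ.symm v)
      rw [Φ.apply_symm_apply] at h3
      rw [← hJ]
      simp [h3]

end Transport

/-! ### Coordinate expressions -/

section Charts

variable {E : Type*} [NormedAddCommGroup E] [NormedSpace ℝ E]
  {M : Type*} [TopologicalSpace M] [ChartedSpace E M]
  {e : OpenPartialHomeomorph M E}

theorem mdifferentiable_of_mem_maximalAtlas (he : e ∈ IsManifold.maximalAtlas 𝓘(ℝ, E) ∞ M) :
    e.MDifferentiable 𝓘(ℝ, E) 𝓘(ℝ, E) :=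
  ⟨(contMDiffOn_of_mem_maximalAtlas he).mdifferentiableOn (by simp),
    (contMDiffOn_symm_of_mem_maximalAtlas he).mdifferentiableOn (by simp)⟩

theorem chartCoframe_chartFrame (he : e ∈ IsManifold.maximalAtlas 𝓘(ℝ, E) ∞ M) {x : E}
    (hx : x ∈ e.target) (u : E) : chartCoframe e x (chartFrame e x u) = u :=
  congrArg (fun L => L u) ((mdifferentiable_of_mem_maximalAtlas he).comp_symm_deriv hx)

theorem chartFrame_chartCoframe (he : e ∈ IsManifold.maximalAtlas 𝓘(ℝ, E) ∞ M) {x : E}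
    (hx : x ∈ e.target) (v : TangentSpace 𝓘(ℝ, E) (e.symm x)) :
    chartFrame e x (chartCoframe e x v) = v :=
  (mdifferentiable_of_mem_maximalAtlas he).mfderiv_injective (e.map_target hx)
    (chartCoframe_chartFrame he hx _)

/-- The coframe of a chart as an isomorphism onto the coordinate space. -/
def chartCoframeEquiv (he : e ∈ IsManifold.maximalAtlas 𝓘(ℝ, E) ∞ M) {x : E}
    (hx : x ∈ e.target) : TangentSpace 𝓘(ℝ, E) (e.symm x) ≃L[ℝ] E :=
  ContinuousLinearEquiv.equivOfInverse (chartCoframe e x) (chartFrame e x)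
    (chartFrame_chartCoframe he hx) (chartCoframe_chartFrame he hx)

variable [IsManifold 𝓘(ℝ, E) ∞ M]

theorem SmoothMetric.inChart_coframe (g : SmoothMetric E M)
    (he : e ∈ IsManifold.maximalAtlas 𝓘(ℝ, E) ∞ M) {x : E} (hx : x ∈ e.target)
    (u v : TangentSpace 𝓘(ℝ, E) (e.symm x)) :
    g.inChart e x (chartCoframeEquiv he hx u) (chartCoframeEquiv he hx v)
      = g.inner (e.symm x) u v := by
  rw [SmoothMetric.inChart_apply]
  exact congrArg₂ (fun a b => g.inner (e.symm x) a b) (chartFrame_chartCoframe he hx u)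
    (chartFrame_chartCoframe he hx v)

theorem EndField.inChart_coframe (J : EndField E M)
    (he : e ∈ IsManifold.maximalAtlas 𝓘(ℝ, E) ∞ M) {x : E} (hx : x ∈ e.target)
    (v : TangentSpace 𝓘(ℝ, E) (e.symm x)) :
    J.inChart e x (chartCoframeEquiv he hx v) = chartCoframeEquiv he hx (J.toFun (e.symm x) v) :=
  congrArg (fun a => chartCoframe e x (J.toFun (e.symm x) a)) (chartFrame_chartCoframe he hx v)

/-- Formulated at a point of the manifold, for use at `φ (e.symm x)`, which is not given as
`e'.symm` of a coordinate point. -/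
theorem SmoothMetric.inChart_mfderiv (g : SmoothMetric E M)
    (he : e ∈ IsManifold.maximalAtlas 𝓘(ℝ, E) ∞ M) {q : M} (hq : q ∈ e.source)
    (u v : TangentSpace 𝓘(ℝ, E) q) :
    g.inChart e (e q) (mfderiv 𝓘(ℝ, E) 𝓘(ℝ, E) e q u) (mfderiv 𝓘(ℝ, E) 𝓘(ℝ, E) e q v)
      = g.inner q u v := by
  obtain ⟨y, hy, rfl⟩ : ∃ y ∈ e.target, q = e.symm y := ⟨e q, e.map_source hq, (e.left_inv hq).symm⟩
  have h := g.inChart_coframe he hy u v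
  conv_lhs => rw [e.right_inv hy]
  exact h

theorem SmoothMetric.isScalarProduct_inChart (g : SmoothMetric E M)
    (he : e ∈ IsManifold.maximalAtlas 𝓘(ℝ, E) ∞ M) {x : E} (hx : x ∈ e.target) :
    IsScalarProduct (g.inChart e x) :=
  (g.isScalarProduct (e.symm x)).map (chartCoframeEquiv he hx) (g.inChart_coframe he hx)

/-- Coordinate fields are images of constant fields under the tangent map of the inverse chart. -/
theorem contMDiffOn_chartFrame (he : e ∈ IsManifold.maximalAtlas 𝓘(ℝ, E) ∞ M) (u : E) :
    ContMDiffOn 𝓘(ℝ, E) (𝓘(ℝ, E).prod 𝓘(ℝ, E)) ∞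
      (fun x => Bundle.TotalSpace.mk' E (E := fun p : M => TangentSpace 𝓘(ℝ, E) p)
        (e.symm x) (chartFrame e x u)) e.target := by
  have h := (contMDiffOn_symm_of_mem_maximalAtlas he).contMDiffOn_tangentMapWithin
    (m := ∞) (by simp) e.open_target.uniqueMDiffOn
  have hu : ContMDiff 𝓘(ℝ, E) (𝓘(ℝ, E).prod 𝓘(ℝ, E)) ∞
      (fun x : E => (⟨x, u⟩ : TangentBundle 𝓘(ℝ, E) E)) :=
    contMDiff_vectorSpace_iff_contDiff.2 contDiff_const
  refine (h.comp (s := e.target) hu.contMDiffOn fun x hx => hx).congr fun x hx => ?_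
  simp only [Function.comp, tangentMapWithin, chartFrame]
  rw [mfderivWithin_of_isOpen e.open_target hx]
  rfl

theorem SmoothMetric.contDiffOn_inChart [FiniteDimensional ℝ E] (g : SmoothMetric E M)
    (he : e ∈ IsManifold.maximalAtlas 𝓘(ℝ, E) ∞ M) :
    ContDiffOn ℝ ∞ (g.inChart e) e.target := by
  rw [contDiffOn_clm_apply]
  intro u
  rw [contDiffOn_clm_apply]
  intro v
  have hs := contMDiffOn_symm_of_mem_maximalAtlas he
  have h : ContMDiffOn 𝓘(ℝ, E) (𝓘(ℝ, E).prod 𝓘(ℝ)) ∞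
      (fun x => Bundle.TotalSpace.mk' ℝ (E := Bundle.Trivial M ℝ) (e.symm x)
        (g.inner (e.symm x) (chartFrame e x u) (chartFrame e x v))) e.target :=
    ContMDiffOn.clm_bundle_apply₂ (F₁ := E) (F₂ := E)
      (g.contMDiff.comp_contMDiffOn hs) (contMDiffOn_chartFrame he u) (contMDiffOn_chartFrame he v)
  rw [← contMDiffOn_iff_contDiffOn]
  intro x hx
  have hx' := h x hx
  rw [Bundle.contMDiffWithinAt_totalSpace] at hx'
  exact hx'.2

theorem EndField.contDiffOn_inChart [FiniteDimensional ℝ E] (J : EndField E M)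
    (he : e ∈ IsManifold.maximalAtlas 𝓘(ℝ, E) ∞ M) :
    ContDiffOn ℝ ∞ (J.inChart e) e.target := by
  rw [contDiffOn_clm_apply]
  intro u
  have hs := contMDiffOn_symm_of_mem_maximalAtlas he
  have h : ContMDiffOn 𝓘(ℝ, E) (𝓘(ℝ, E).prod 𝓘(ℝ, E)) ∞
      (fun x => Bundle.TotalSpace.mk' E (E := fun p : M => TangentSpace 𝓘(ℝ, E) p) (e.symm x)
        (J.toFun (e.symm x) (chartFrame e x u))) e.target :=
    ContMDiffOn.clm_bundle_apply (F₁ := E) (F₂ := E)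
      (J.contMDiff.comp_contMDiffOn hs) (contMDiffOn_chartFrame he u)
  -- The tangent map of the chart sends this smooth section to the tangent bundle of the model
  -- space, where the fibre component is globally defined.
  have ht := (contMDiffOn_of_mem_maximalAtlas he).contMDiffOn_tangentMapWithin
    (m := ∞) (by simp) e.open_source.uniqueMDiffOn
  have h2 := ht.comp (s := e.target) h fun x hx => e.map_target hx
  have h3 := contMDiff_snd_tangentBundle_modelSpace E 𝓘(ℝ, E) (n := ∞) |>.comp_contMDiffOn h2
  rw [← contMDiffOn_iff_contDiffOn]
  refine h3.congr fun x hx => ?_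
  simp only [Function.comp, tangentMapWithin]
  rw [mfderivWithin_of_isOpen e.open_source (e.map_target hx)]
  rfl

theorem isKaehlerCurvature_riemann_inChart [FiniteDimensional ℝ E]
    {g : SmoothMetric E M} {J : EndField E M}
    (he : e ∈ IsManifold.maximalAtlas 𝓘(ℝ, E) ∞ M)
    (hK : IsLorentzianKaehler g J) {y : E} (hy : y ∈ e.target) :
    IsKaehlerCurvature (g.inChart e y) (J.inChart e y) (riemann (g.inChart e) y) := by
  have hH := (hK.hermitian _).map (chartCoframeEquiv he hy)
    (g.inChart_coframe he hy) (J.inChart_coframe he hy)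
  exact isKaehlerCurvature_riemann e.open_target hy (g.contDiffOn_inChart he)
    (fun z hz => g.isScalarProduct_inChart he hz) (J.contDiffOn_inChart he) hH.sq hH.hermitian
    fun z hz u a => sub_eq_zero.1 (hK.parallel e he z hz u a)

end Charts

/-! ### Isometric immersions -/

section Immersion

variable {E W : Type*} [NormedAddCommGroup E] [NormedSpace ℝ E]
  [NormedAddCommGroup W] [NormedSpace ℝ W]
  {M : Type*} [TopologicalSpace M] [ChartedSpace E M]
  {N : Type*} [TopologicalSpace N] [ChartedSpace W N]
  {φ : M → N} {e : OpenPartialHomeomorph M E} {e' : OpenPartialHomeomorph N W}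

theorem contDiffOn_mapInCharts
    (he : e ∈ IsManifold.maximalAtlas 𝓘(ℝ, E) ∞ M)
    (he' : e' ∈ IsManifold.maximalAtlas 𝓘(ℝ, W) ∞ N)
    (hφ : ContMDiff 𝓘(ℝ, E) 𝓘(ℝ, W) ∞ φ) :
    ContDiffOn ℝ ∞ (mapInCharts φ e e') (e.target ∩ e.symm ⁻¹' (φ ⁻¹' e'.source)) := by
  rw [← contMDiffOn_iff_contDiffOn]
  exact (contMDiffOn_of_mem_maximalAtlas he').comp (hφ.comp_contMDiffOn
    ((contMDiffOn_symm_of_mem_maximalAtlas he).mono Set.inter_subset_left)) fun x hx => hx.2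

theorem fderiv_mapInCharts
    (he : e ∈ IsManifold.maximalAtlas 𝓘(ℝ, E) ∞ M)
    (he' : e' ∈ IsManifold.maximalAtlas 𝓘(ℝ, W) ∞ N)
    (hφ : ContMDiff 𝓘(ℝ, E) 𝓘(ℝ, W) ∞ φ) {x : E} (hx : x ∈ e.target)
    (hx' : φ (e.symm x) ∈ e'.source) (u : E) :
    fderiv ℝ (mapInCharts φ e e') x u = mfderiv 𝓘(ℝ, W) 𝓘(ℝ, W) e' (φ (e.symm x))
      (mfderiv 𝓘(ℝ, E) 𝓘(ℝ, W) φ (e.symm x) (chartFrame e x u)) := by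
  have d1 := (mdifferentiable_of_mem_maximalAtlas he).mdifferentiableAt_symm hx
  have d2 : MDifferentiableAt 𝓘(ℝ, E) 𝓘(ℝ, W) φ (e.symm x) := hφ.mdifferentiable (by simp) _
  have d3 := (mdifferentiable_of_mem_maximalAtlas he').mdifferentiableAt hx'
  rw [← mfderiv_eq_fderiv]
  have h1 := mfderiv_comp x (d3 : MDifferentiableAt 𝓘(ℝ, W) 𝓘(ℝ, W) e' ((φ ∘ e.symm) x))
    (d2.comp x d1)
  have h2 := mfderiv_comp x d2 d1
  rw [h2] at h1
  exact congrArg (fun L => L u) h1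

variable [IsManifold 𝓘(ℝ, E) ∞ M] [IsManifold 𝓘(ℝ, W) ∞ N]
  [FiniteDimensional ℝ E] [FiniteDimensional ℝ W]

/-- The geometry of an isometric immersion of a Lorentz surface into a Lorentzian Kaehler
surface. -/
theorem isLorentzKaehler_immersionData
    (he : e ∈ IsManifold.maximalAtlas 𝓘(ℝ, E) ∞ M)
    (he' : e' ∈ IsManifold.maximalAtlas 𝓘(ℝ, W) ∞ N)
    {g : SmoothMetric E M} {gt : SmoothMetric W N}
    {J : EndField W N} (hl : ∀ p, IsLorentzian (g.inner p)) (hK : IsLorentzianKaehler gt J)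
    (hφ : IsIsometricImmersion g gt φ) : (immersionData g gt J φ e e').IsLorentzKaehler := by
  have ho : IsOpen (e.target ∩ e.symm ⁻¹' (φ ⁻¹' e'.source)) :=
    e.isOpen_inter_preimage_symm (e'.open_source.preimage hφ.smooth.continuous)
  have hψ := contDiffOn_mapInCharts he he' hφ.smooth
  have hι := hψ.fderiv_infty ho
  have hmap : Set.MapsTo (mapInCharts φ e e') (e.target ∩ e.symm ⁻¹' (φ ⁻¹' e'.source)) e'.target :=
    fun x hx => e'.map_source hx.2
  have hgt := gt.contDiffOn_inChart he'
  have hJ := J.contDiffOn_inChart he'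
  have hsc : ∀ y ∈ e'.target, IsScalarProduct (gt.inChart e' y) := fun y hy =>
    gt.isScalarProduct_inChart he' hy
  have hch := contDiffOn_christoffel e'.open_target hgt hsc
  refine
    { isOpen := ho
      smooth_g := (g.contDiffOn_inChart he).mono Set.inter_subset_left
      smooth_ι := hι
      smooth_G := hgt.comp hψ hmap
      smooth_J := hJ.comp hψ hmap
      smooth_θ := (hch.comp hψ hmap).clm_comp hι
      scalar_g := fun x hx => g.isScalarProduct_inChart he hx.1
      lorentz_g := fun x hx =>
        (hl (e.symm x)).map (chartCoframeEquiv he hx.1) (g.inChart_coframe he hx.1)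
      scalar_G := fun x hx => hsc _ (hmap hx)
      hermitian := fun x hx => (hK.hermitian _).map (chartCoframeEquiv he' (hmap hx))
        (gt.inChart_coframe he' (hmap hx)) (J.inChart_coframe he' (hmap hx))
      isometric := fun x hx u v => ?_
      parallel_G := fun x hx u a b => ?_
      parallel_J := fun x hx u a => ?_
      torsion_free := fun x hx u v => ?_ }
  · have h1 := fderiv_mapInCharts he he' hφ.smooth hx.1 hx.2
    change gt.inChart e' (e' (φ (e.symm x))) (fderiv ℝ (mapInCharts φ e e') x u)
      (fderiv ℝ (mapInCharts φ e e') x v) = g.inChart e x u v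
    rw [h1, h1, gt.inChart_mfderiv he' hx.2, hφ.isometric, SmoothMetric.inChart_apply]
  · have h1 : fderiv ℝ (fun y => gt.inChart e' (mapInCharts φ e e' y)) x
        = (fderiv ℝ (gt.inChart e') (mapInCharts φ e e' x)).comp
          (fderiv ℝ (mapInCharts φ e e') x) :=
      fderiv_fun_comp x (hgt.differentiableAt_of_isOpen e'.open_target (hmap hx))
        (hψ.differentiableAt_of_isOpen ho hx)
    change fderiv ℝ (fun y => gt.inChart e' (mapInCharts φ e e' y)) x u a b = _
    rw [h1]
    exact fderiv_metric_eq e'.open_target (hmap hx) hgt hsc _ a b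
  · have h1 : fderiv ℝ (fun y => J.inChart e' (mapInCharts φ e e' y)) x
        = (fderiv ℝ (J.inChart e') (mapInCharts φ e e' x)).comp
          (fderiv ℝ (mapInCharts φ e e') x) :=
      fderiv_fun_comp x (hJ.differentiableAt_of_isOpen e'.open_target (hmap hx))
        (hψ.differentiableAt_of_isOpen ho hx)
    have h2 := hK.parallel e' he' _ (hmap hx) (fderiv ℝ (mapInCharts φ e e') x u) a
    change fderiv ℝ (fun y => J.inChart e' (mapInCharts φ e e' y)) x u a + _ = _
    rw [h1]
    exact sub_eq_zero.1 h2
  -- Torsion-freeness is the symmetry of second derivatives of the coordinate map together with that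
  -- of the ambient Christoffel symbols.
  · change fderiv ℝ (fderiv ℝ (mapInCharts φ e e')) x u v
        + christoffel (gt.inChart e') (mapInCharts φ e e' x) _ _
      = fderiv ℝ (fderiv ℝ (mapInCharts φ e e')) x v u
        + christoffel (gt.inChart e') (mapInCharts φ e e' x) _ _
    rw [hψ.fderiv_fderiv_comm ho hx u v, christoffel_symm e'.open_target (hmap hx) hgt hsc]
    rfl

end Immersion

/-- The equation of Ricci is a consequence of the equations of Gauss and Codazzi, for an
isometric immersion. -/
theorem holdsAt_ricciAt {E W : Type*} [NormedAddCommGroup E] [NormedSpace ℝ E]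
    [NormedAddCommGroup W] [NormedSpace ℝ W] [FiniteDimensional ℝ E] [FiniteDimensional ℝ W]
    (hE : Module.finrank ℝ E = 2) (hW : Module.finrank ℝ W = 4)
    {M : Type*} [TopologicalSpace M] [ChartedSpace E M] [IsManifold 𝓘(ℝ, E) ∞ M]
    {N : Type*} [TopologicalSpace N] [ChartedSpace W N] [IsManifold 𝓘(ℝ, W) ∞ N]
    {g : SmoothMetric E M} {gt : SmoothMetric W N} {J : EndField W N} {φ : M → N}
    (hl : ∀ p, IsLorentzian (g.inner p)) (hK : IsLorentzianKaehler gt J)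
    (hφ : IsIsometricImmersion g gt φ) {p : M} (hG : HoldsAt SurfaceData.GaussAt g gt J φ p)
    (hC : HoldsAt SurfaceData.CodazziAt g gt J φ p) :
    HoldsAt SurfaceData.RicciAt g gt J φ p := by
  intro e he hp e' he' hp'
  have hx : e p ∈ (immersionData g gt J φ e e').dom :=
    ⟨e.map_source hp, by simpa [e.left_inv hp] using hp'⟩
  exact (isLorentzKaehler_immersionData he he' hl hK hφ).ricciAt hE hW hx
    (isKaehlerCurvature_riemann_inChart he' hK (e'.map_source hx.2))
    (hG e he hp e' he' hp') (hC e he hp e' he' hp')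

end LorentzKaehler

end

/-- The equation of Ricci is a consequence of the equations of Gauss and Codazzi for Lorentz
surfaces in Lorentzian Kaehler surfaces. The first part is about the actual objects of an isometric
immersion. The second part expresses the dependence between the equations: there the ambient
curvature is an arbitrary tensor with the Kaehler symmetries, which is not assumed to be the
curvature of the connection `∇̃` of the Gauss and Weingarten formulas. -/
theorem theorem1 :
    (∀ (M : Type*) [TopologicalSpace M] [ChartedSpace (EuclideanSpace ℝ (Fin 2)) M]
        [IsManifold 𝓘(ℝ, EuclideanSpace ℝ (Fin 2)) ∞ M]
        (N : Type*) [TopologicalSpace N] [ChartedSpace (EuclideanSpace ℝ (Fin 4)) N]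
        [IsManifold 𝓘(ℝ, EuclideanSpace ℝ (Fin 4)) ∞ N]
        (g : LorentzKaehler.SmoothMetric (EuclideanSpace ℝ (Fin 2)) M)
        (gt : LorentzKaehler.SmoothMetric (EuclideanSpace ℝ (Fin 4)) N)
        (J : LorentzKaehler.EndField (EuclideanSpace ℝ (Fin 4)) N) (φ : M → N),
        (∀ p, LorentzKaehler.IsLorentzian (g.inner p)) →
        LorentzKaehler.IsLorentzianKaehler gt J →
        LorentzKaehler.IsIsometricImmersion g gt φ →
        ∀ p : M,
          LorentzKaehler.HoldsAt LorentzKaehler.SurfaceData.GaussAt g gt J φ p →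
          LorentzKaehler.HoldsAt LorentzKaehler.SurfaceData.CodazziAt g gt J φ p →
          LorentzKaehler.HoldsAt LorentzKaehler.SurfaceData.RicciAt g gt J φ p) ∧
    (∀ S : LorentzKaehler.SurfaceData (EuclideanSpace ℝ (Fin 2)) (EuclideanSpace ℝ (Fin 4)),
        S.IsLorentzKaehler →
        ∀ x ∈ S.dom, ∀ Rt : EuclideanSpace ℝ (Fin 4) →L[ℝ] EuclideanSpace ℝ (Fin 4) →L[ℝ]
            EuclideanSpace ℝ (Fin 4) →L[ℝ] EuclideanSpace ℝ (Fin 4),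
          LorentzKaehler.IsKaehlerCurvature (S.G x) (S.J x) Rt →
          S.GaussAt Rt x → S.CodazziAt Rt x → S.RicciAt Rt x) := by
  refine ⟨?_, ?_⟩
  · intro M _ _ _ N _ _ _ g gt J φ hl hK hφ p hG hC
    exact LorentzKaehler.holdsAt_ricciAt (by simp) (by simp) hl hK hφ hG hC
  · intro S hS x hx Rt hR hG hC
    exact hS.ricciAt (by simp) (by simp) hx hR hG hC
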